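/- Write the closed upper half plane as $\overline{\mathbb H}=\{(y_1,y_2): y_2\ge 0\}$, with interior $\mathbb H$. For a curve $\gamma=(\gamma^1,\gamma^2)$ into $\mathbb H$ let $S(\gamma)\subset\mathbb R^3$ be the surface of revolution parametrised by $(s,\varphi)\mapsto(\gamma^1(s),\gamma^2(s)\cos\varphi,\gamma^2(s)\sin\varphi)$, and let $W_e=\frac14\int H^2\,d\mu$ be its Willmore energy ($H$ is the sum of the principal curvatures, $\mu$ the induced area measure). For a surface $S$ let $\theta^2(\mathcal H^2\lfloor S,\infty)=\lim_{R\to\infty}\mathcal H^2(S\cap B_R(0))/(\pi R^2)$. Given $\alpha_\pm>0$, angles $\beta_\pm$ and $x_\pm\in\mathbb R$, let $\operatorname{cap}_\pm$ be the surface obtained by rotating the part of the circle with centre on the axis (or of the vertical line) through $(x_\pm,\alpha_\pm)$ with tangent $(\cos\beta_\pm,\sin\beta_\pm)$ there that lies behind this point, i.e. in direction $-(\cos\beta_\pm,\sin\beta_\pm)$. For a surface of revolution $S$ whose profile curve joins $(x_-,\alpha_-)$ to $(x_+,\alpha_+)$ with these boundary angles (initial direction $(\cos\beta_-,\sin\beta_-)$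 at the first point, final direction $-(\cos\beta_+,\sin\beta_+)$ at the second) define the closed Willmore energy $$W^e_{closed}(S)=W_e(S)+W_e(\operatorname{cap}_-)+W_e(\operatorname{cap}_+)+4\pi\big(\theta^2(\mathcal H^2\lfloor S,\infty)+\theta^2(\mathcal H^2\lfloor \operatorname{cap}_-,\infty)+\theta^2(\mathcal H^2\lfloor \operatorname{cap}_+,\infty)\big).$$ For $x\in\mathbb R\cup\{\infty\}$ let $c^x$ be the union of two curves $c^x_\pm:[0,1)\to\mathbb H$, smooth and regular, with $c^x_\pm(0)=(x_\pm,\alpha_\pm)$, initial direction $(\cos\beta_\pm,\sin\beta_\pm)$, and $c^x_\pm(s)\to(x,0)$ (respectively $|c^x_\pm(s)|\to\infty$ if $x=\infty$) as $s\to1$, each of which is part of the image of the catenary $\{(t,\cosh t)\}$ under a Moebius transformation of $\mathbb H$ or part of a half circle with centre on the $y_1$-axis. Here $c^x_-$ is run forwards and $c^x_+$ backwards. **Theorem 1.2.** Let $\alpha_+,\alpha_->0$, $\beta_-=0$, $\beta_+=\pi$ and $x_\pm=\pm1$. A curve $c^x$ exists if and only if $x\ne-1-\alpha_-$ and $x\neq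 1+\alpha_+$. Every such $c^x$ with $x\in\mathbb R$ satisfies $$W^e_{closed}(S(c^x)) = 12\pi+ 4\pi\left(\frac{\alpha_+(x-1)}{\alpha_+^2 + (x-1)^2} - \frac{\alpha_-(x+1)}{\alpha_-^2 + (x+1)^2}\right),$$ and for $x=\infty$ one has $W^e_{closed}(S(c^\infty))=12\pi$. Furthermore, for fixed $\alpha_->0$, $$\liminf_{\alpha_+\to\infty}\ \inf\{W^e_{closed}(S(c^x)) : x\in\mathbb R\cup\{\infty\},\ c^x\text{ exists}\}\ \ge\ 10\pi .$$ -/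

import Mathlib

open Real Set Filter Topology MeasureTheory
open scoped ENNReal ContDiff

noncomputable section

/-! ### Parametrised surfaces in `ℝ³` and their Willmore energy -/

/-- Euclidean three-space. -/
abbrev E3 : Type := EuclideanSpace ℝ (Fin 3)

/-- The cross product on Euclidean three-space. -/
def cross3 (v w : E3) : E3 := WithLp.toLp 2 (crossProduct (WithLp.ofLp v) (WithLp.ofLp w))

namespace ParamSurface

/-- Partial derivative in the first parameter. -/
def d1 (f : ℝ → ℝ → E3) (s φ : ℝ) : E3 := deriv (fun u => f u φ) s

/-- Partial derivative in the second parameter. -/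
def d2 (f : ℝ → ℝ → E3) (s φ : ℝ) : E3 := deriv (fun v => f s v) φ

/-- Coefficients `E`, `F`, `G` of the first fundamental form. -/
def coeffE (f : ℝ → ℝ → E3) (s φ : ℝ) : ℝ := inner ℝ (d1 f s φ) (d1 f s φ)

/-- See `coeffE`. -/
def coeffF (f : ℝ → ℝ → E3) (s φ : ℝ) : ℝ := inner ℝ (d1 f s φ) (d2 f s φ)

/-- See `coeffE`. -/
def coeffG (f : ℝ → ℝ → E3) (s φ : ℝ) : ℝ := inner ℝ (d2 f s φ) (d2 f s φ)

/-- The determinant `E G - F ^ 2` of the induced metric. -/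
def metricDet (f : ℝ → ℝ → E3) (s φ : ℝ) : ℝ :=
  coeffE f s φ * coeffG f s φ - coeffF f s φ ^ 2

/-- The unit normal of the parametrised surface. -/
def unitNormal (f : ℝ → ℝ → E3) (s φ : ℝ) : E3 :=
  (‖cross3 (d1 f s φ) (d2 f s φ)‖)⁻¹ • cross3 (d1 f s φ) (d2 f s φ)

/-- Coefficients `L`, `M`, `N` of the second fundamental form. -/
def coeffL (f : ℝ → ℝ → E3) (s φ : ℝ) : ℝ := inner ℝ (d1 (d1 f) s φ) (unitNormal f s φ)

/-- See `coeffL`. -/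
def coeffM (f : ℝ → ℝ → E3) (s φ : ℝ) : ℝ := inner ℝ (d1 (d2 f) s φ) (unitNormal f s φ)

/-- See `coeffL`. -/
def coeffN (f : ℝ → ℝ → E3) (s φ : ℝ) : ℝ := inner ℝ (d2 (d2 f) s φ) (unitNormal f s φ)

/-- The scalar mean curvature, i.e. the sum of the principal curvatures: the trace of the second
fundamental form with respect to the first one. -/
def meanCurvature (f : ℝ → ℝ → E3) (s φ : ℝ) : ℝ :=
  (coeffL f s φ * coeffG f s φ - 2 * coeffM f s φ * coeffF f s φ + coeffN f s φ * coeffE f s φ)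
    / metricDet f s φ

/-- The Willmore energy `(1/4) ∫ H² dμ_f` of the part of the surface that is parametrised by `D`,
as an extended nonnegative number. -/
def willmore (f : ℝ → ℝ → E3) (D : Set (ℝ × ℝ)) : ℝ≥0∞ :=
  ∫⁻ p in D, ENNReal.ofReal
    (1 / 4 * meanCurvature f p.1 p.2 ^ 2 * √(metricDet f p.1 p.2))

end ParamSurface

/-! ### Surfaces of revolution

A profile curve is a map into the upper half plane, whose points `(x, y)` are written as complex
numbers `x + i y`. It is rotated around the first coordinate axis of `ℝ³`. -/

/-- The parametrisation of the surface of revolution with profile curve `γ`. -/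
def revParam (γ : ℝ → ℂ) (s φ : ℝ) : E3 :=
  !₂[(γ s).re, (γ s).im * Real.cos φ, (γ s).im * Real.sin φ]

/-- The surface of revolution of `γ` restricted to the parameter set `I`, as a subset of `ℝ³`. -/
def revSurface (γ : ℝ → ℂ) (I : Set ℝ) : Set E3 :=
  {p | ∃ s ∈ I, ∃ φ : ℝ, p = revParam γ s φ}

/-- The Willmore energy of the surface of revolution of `γ` restricted to `I`. -/
def revWillmore (γ : ℝ → ℂ) (I : Set ℝ) : ℝ≥0∞ :=
  ParamSurface.willmore (revParam γ) (I ×ˢ Ioc 0 (2 * π))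

/-- The `2`-density at infinity of the measure `ℋ²⌊S`, the limit of `ℋ²(S ∩ B_R) / (π R²)` as
`R → ∞` (written as a `limsup`, which is the limit whenever the limit exists). Here `ℋ²` is the
Hausdorff measure normalised to agree with Lebesgue measure on planes. -/
def densityAtInfinity (S : Set E3) : ℝ≥0∞ :=
  limsup (fun R : ℝ =>
    ((Measure.euclideanHausdorffMeasure 2 : Measure E3).restrict S) (Metric.closedBall 0 R)
      / ENNReal.ofReal (π * R ^ 2)) atTop

/-! ### Sphere caps and the closed Willmore energy -/

/-- The part of a circle with centre on the axis, or of a vertical line, that ends at `(x₀, α₀)`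
with direction `(cos β₀, sin β₀)` and starts on the axis or at infinity. -/
def gammaCirc (x₀ α₀ β₀ : ℝ) : Set ℂ :=
  if Real.cos β₀ ≠ 0 then
    {z | 0 < z.im ∧ (z.re - x₀ - α₀ * Real.tan β₀) ^ 2 + z.im ^ 2 = α₀ ^ 2 / Real.cos β₀ ^ 2 ∧
      Real.cos β₀ * (z.re - x₀) ≤ 0}
  else
    {z | z.re = x₀ ∧ 0 < z.im ∧ 0 ≤ (α₀ - z.im) * Real.sin β₀}

/-- The parametrisation of `gammaCirc x₀ α₀ β₀` over `(-∞, 0]` by hyperbolic arc length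
(see `image_capCurve`). -/
def capCurve (x₀ α₀ β₀ : ℝ) (t : ℝ) : ℂ :=
  ⟨x₀ + α₀ * (Real.cos β₀ * Real.sinh t) / (Real.cosh t - Real.sin β₀ * Real.sinh t),
    α₀ / (Real.cosh t - Real.sin β₀ * Real.sinh t)⟩

/-- The closed Willmore energy of the surface of revolution of `γ` restricted to `I`, where `γ`
runs from `(xm, αm)` to `(xp, αp)` with boundary angles `βm` and `βp`: the Willmore energies of the
surface and of the two sphere caps, plus `4π` times their densities at infinity. -/
def closedWillmore (xm αm βm xp αp βp : ℝ) (γ : ℝ → ℂ) (I : Set ℝ) : ℝ≥0∞ :=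
  revWillmore γ I
    + revWillmore (capCurve xm αm βm) (Iic 0)
    + revWillmore (capCurve xp αp βp) (Iic 0)
    + ENNReal.ofReal (4 * π) * densityAtInfinity (revSurface γ I)
    + ENNReal.ofReal (4 * π) * densityAtInfinity (revSurface (capCurve xm αm βm) (Iic 0))
    + ENNReal.ofReal (4 * π) * densityAtInfinity (revSurface (capCurve xp αp βp) (Iic 0))

/-! ### The singular comparison curves `cˣ` -/

/-- The image of the catenary `t ↦ (t, cosh t)` under the map `z ↦ (a z + b) / (c z + d)`.
(As the catenary is symmetric under `x ↦ -x`, orientation reversing Moebius transformations of the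
half plane give no further images.) -/
def moebiusCatenary (a b c d : ℝ) : Set ℂ :=
  range fun t : ℝ =>
    ((a : ℂ) * ⟨t, Real.cosh t⟩ + b) / ((c : ℂ) * ⟨t, Real.cosh t⟩ + d)

/-- The half circle in the upper half plane with centre `m` on the axis and radius `r`. -/
def halfCircle (m r : ℝ) : Set ℂ := {z | 0 < z.im ∧ (z.re - m) ^ 2 + z.im ^ 2 = r ^ 2}

/-- `c : [0, 1) → ℍ` is a smooth regular curve that starts at `(x₀, α₀)` with direction
`(cos β₀, sin β₀)`, runs into the boundary point `x ∈ ℝ ∪ {∞}` of the half plane as `s → 1`, and is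
part of a Moebius transformed catenary or of a half circle with centre on the axis. -/
structure IsSingularArc (x₀ α₀ β₀ : ℝ) (x : OnePoint ℝ) (c : ℝ → ℂ) : Prop where
  smooth : ContDiffOn ℝ ∞ c (Ico 0 1)
  regular : ∀ s ∈ Ico (0 : ℝ) 1, derivWithin c (Ico 0 1) s ≠ 0
  start : c 0 = ⟨x₀, α₀⟩
  direction : derivWithin c (Ico 0 1) 0
    = (‖derivWithin c (Ico 0 1) 0‖ : ℂ) * ⟨Real.cos β₀, Real.sin β₀⟩
  tendsto_real : ∀ a : ℝ, x = (a : OnePoint ℝ) → Tendsto c (𝓝[<] 1) (𝓝 (a : ℂ))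
  tendsto_infty : x = OnePoint.infty → Tendsto (fun s => ‖c s‖) (𝓝[<] 1) atTop
  shape : (∃ a b c' d : ℝ, 0 < a * d - b * c' ∧ ∀ s ∈ Ico (0 : ℝ) 1, c s ∈ moebiusCatenary a b c' d)
    ∨ (∃ m r : ℝ, 0 < r ∧ ∀ s ∈ Ico (0 : ℝ) 1, c s ∈ halfCircle m r)

/-- The union of `cm`, run forwards over `[0, 1)`, and `cp`, run backwards over `(1, 2]`. -/
def unionCurve (cm cp : ℝ → ℂ) (s : ℝ) : ℂ := if s < 1 then cm s else cp (2 - s)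

/-- The closed Willmore energy of the surface of revolution of the union `cˣ` of `cm` and `cp`.
The parameter `1`, where `cˣ` meets the boundary of the half plane, is left out. -/
def singularEnergy (xm αm βm xp αp βp : ℝ) (cm cp : ℝ → ℂ) : ℝ≥0∞ :=
  closedWillmore xm αm βm xp αp βp (unionCurve cm cp) (Icc 0 2 \ {1})

/-- The infimum of the closed Willmore energies of `S(cˣ)` over all `x ∈ ℝ ∪ {∞}`
(and all admissible curves `cˣ`). -/
def infSingularEnergy (xm αm βm xp αp βp : ℝ) : ℝ≥0∞ :=
  ⨅ (x : OnePoint ℝ) (cm : ℝ → ℂ) (cp : ℝ → ℂ) (_ : IsSingularArc xm αm βm x cm)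
    (_ : IsSingularArc xp αp βp x cp), singularEnergy xm αm βm xp αp βp cm cp

/-! ### `capCurve` parametrises `gammaCirc` -/

theorem capCurve_denom_pos (β t : ℝ) : 0 < Real.cosh t - Real.sin β * Real.sinh t := by
  have h1 : |Real.sin β * Real.sinh t| ≤ |Real.sinh t| := by
    rw [abs_mul]
    exact mul_le_of_le_one_left (abs_nonneg _) (Real.abs_sin_le_one β)
  have h2 : |Real.sinh t| < Real.cosh t := by
    rw [abs_lt]
    constructor <;> nlinarith [Real.cosh_sq t, Real.cosh_pos t]
  linarith [le_abs_self (Real.sin β * Real.sinh t)]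

theorem image_capCurve (x₀ β₀ : ℝ) {α₀ : ℝ} (hα : 0 < α₀) :
    capCurve x₀ α₀ β₀ '' Iic 0 = gammaCirc x₀ α₀ β₀ := by
  have key : ∀ t : ℝ, 0 < Real.cosh t - Real.sin β₀ * Real.sinh t := capCurve_denom_pos β₀
  have sc := Real.sin_sq_add_cos_sq β₀
  by_cases hc : Real.cos β₀ = 0
  · rw [gammaCirc, if_neg (by simpa using hc)]
    have hs : Real.sin β₀ = 1 ∨ Real.sin β₀ = -1 := by
      rw [hc] at sc
      have h : (Real.sin β₀ - 1) * (Real.sin β₀ + 1) = 0 := by linear_combination sc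
      rcases mul_eq_zero.mp h with h | h
      · exact Or.inl (by linarith)
      · exact Or.inr (by linarith)
    have hD : ∀ t, Real.cosh t - Real.sin β₀ * Real.sinh t = Real.exp (-(Real.sin β₀ * t)) := by
      intro t
      rcases hs with h | h <;> rw [h, Real.cosh_eq, Real.sinh_eq] <;> ring_nf
    ext z
    constructor
    · rintro ⟨t, ht, rfl⟩
      have ht' : t ≤ 0 := ht
      refine ⟨by simp [capCurve, hc], by simpa [capCurve] using div_pos hα (key t), ?_⟩
      have e : α₀ / Real.exp (-(Real.sin β₀ * t)) = α₀ * Real.exp (Real.sin β₀ * t) := by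
        rw [Real.exp_neg, div_inv_eq_mul]
      simp only [capCurve, hD, e]
      rcases hs with h | h <;> rw [h]
      · have : Real.exp (1 * t) ≤ 1 := Real.exp_le_one_iff.mpr (by linarith)
        nlinarith
      · have : 1 ≤ Real.exp (-1 * t) := Real.one_le_exp (by linarith)
        nlinarith
    · rintro ⟨hx, hy, h0⟩
      refine ⟨Real.sin β₀ * Real.log (z.im / α₀), ?_, ?_⟩
      · rcases hs with h | h <;> rw [h] at h0 ⊢ <;> simp only [mem_Iic]
        · have := Real.log_nonpos (div_pos hy hα).le ((div_le_one hα).mpr (by linarith))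
          linarith
        · have := Real.log_nonneg ((one_le_div hα).mpr (by linarith : α₀ ≤ z.im))
          linarith
      · have hsq : Real.sin β₀ * (Real.sin β₀ * Real.log (z.im / α₀)) = Real.log (z.im / α₀) := by
          rcases hs with h | h <;> rw [h] <;> ring
        apply Complex.ext
        · simp [capCurve, hc, hx]
        · simp only [capCurve, hD, hsq]
          rw [Real.exp_neg, div_inv_eq_mul, Real.exp_log (div_pos hy hα)]
          field_simp
  · rw [gammaCirc, if_pos hc]
    have cpos : 0 < Real.cos β₀ ^ 2 := by positivity
    ext z
    constructor
    · rintro ⟨t, ht, rfl⟩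
      have hD := key t
      refine ⟨by simpa [capCurve] using div_pos hα hD, ?_, ?_⟩
      · simp only [capCurve, Real.tan_eq_sin_div_cos]
        have h1 := Real.cosh_sq t
        generalize Real.cosh t = C at *
        generalize Real.sinh t = S at *
        generalize Real.sin β₀ = a at *
        generalize Real.cos β₀ = b at *
        obtain ⟨D, hDdef⟩ : ∃ D, D = C - a * S := ⟨_, rfl⟩
        rw [← hDdef] at hD ⊢
        have hC : C = D + a * S := by linarith
        rw [hC] at h1
        have hD' : D ≠ 0 := hD.ne'
        have e : (x₀ + α₀ * (b * S) / D - x₀ - α₀ * (a / b)) ^ 2 + (α₀ / D) ^ 2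
            = α₀ ^ 2 * ((b ^ 2 * S - a * D) ^ 2 + b ^ 2) / (b ^ 2 * D ^ 2) := by
          field_simp
          ring
        have e' : (b ^ 2 * S - a * D) ^ 2 + b ^ 2 = D ^ 2 := by
          linear_combination (D ^ 2 + b ^ 2 * S ^ 2) * sc - b ^ 2 * h1
        rw [e, e']
        field_simp
      · have hS : Real.sinh t ≤ 0 := Real.sinh_nonpos_iff.mpr ht
        have : Real.cos β₀ * ((capCurve x₀ α₀ β₀ t).re - x₀)
            = α₀ * Real.cos β₀ ^ 2 / (Real.cosh t - Real.sin β₀ * Real.sinh t) * Real.sinh t := by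
          simp only [capCurve]
          ring
        rw [this]
        exact mul_nonpos_of_nonneg_of_nonpos (by positivity) hS
    · rintro ⟨hy, h1, h2⟩
      obtain ⟨x, y⟩ := z
      simp only at hy h1 h2
      rw [Real.tan_eq_sin_div_cos] at h1
      set a := Real.sin β₀
      set b := Real.cos β₀
      have e1 : α₀ ^ 2 + 2 * α₀ * (x - x₀) * (a / b) = y ^ 2 + (x - x₀) ^ 2 := by
        have : α₀ ^ 2 / b ^ 2 = α₀ ^ 2 + (α₀ * (a / b)) ^ 2 := by
          field_simp
          linarith
        rw [this] at h1
        linarith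
      have e2 : 0 < α₀ + (x - x₀) * (a / b) := by
        have : 0 < α₀ * (α₀ + 2 * ((x - x₀) * (a / b))) := by nlinarith [sq_nonneg (x - x₀)]
        have := (mul_pos_iff_of_pos_left hα).mp this
        linarith
      have hsinh : Real.sinh (Real.arsinh ((x - x₀) / (y * b))) = (x - x₀) / (y * b) :=
        Real.sinh_arsinh _
      have hcosh : Real.cosh (Real.arsinh ((x - x₀) / (y * b)))
          = (α₀ + (x - x₀) * (a / b)) / y := by
        rw [Real.cosh_arsinh, Real.sqrt_eq_iff_mul_self_eq (by positivity) (by positivity)]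
        have e3 : (α₀ + (x - x₀) * (a / b)) ^ 2 = y ^ 2 + (x - x₀) ^ 2 / b ^ 2 := by
          have : (x - x₀) ^ 2 / b ^ 2 = (x - x₀) ^ 2 + ((x - x₀) * (a / b)) ^ 2 := by
            field_simp
            linear_combination (-(x - x₀) ^ 2) * sc
          rw [this]
          linarith
        symm
        calc (α₀ + (x - x₀) * (a / b)) / y * ((α₀ + (x - x₀) * (a / b)) / y)
            = (α₀ + (x - x₀) * (a / b)) ^ 2 / y ^ 2 := by ring
          _ = 1 + ((x - x₀) / (y * b)) ^ 2 := by
            rw [e3]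
            field_simp
      have hD : (α₀ + (x - x₀) * (a / b)) / y - a * ((x - x₀) / (y * b)) = α₀ / y := by
        field_simp
        ring
      refine ⟨Real.arsinh ((x - x₀) / (y * b)), ?_, ?_⟩
      · rw [mem_Iic, Real.arsinh_nonpos_iff]
        have : (x - x₀) / (y * b) = b * (x - x₀) / (y * b ^ 2) := by field_simp
        rw [this]
        exact div_nonpos_of_nonpos_of_nonneg h2 (by positivity)
      · apply Complex.ext
        · simp only [capCurve]
          rw [hsinh, hcosh, hD]
          field_simp
          ring
        · simp only [capCurve]
          rw [hsinh, hcosh, hD]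
          field_simp

end

/-!
For a profile curve `c` in the upper half plane, the Willmore integrand of the surface of
revolution and a quarter of the squared hyperbolic curvature times the hyperbolic length element
differ by the derivative of the sine of the tangent angle (`revIntegrand_add_sinDirDeriv`). The
latter integrand is invariant under Moebius transformations (`hypIntegrand_neg_inv`). Let `c` be
an arc of `cˣ` with `x` real and let `g = -1 / (c - x)`. The limit of `c` at its end forces the
catenary to be moved in such a way that its point `∞` goes to `x`, so that `g` lies on a scaled
and translated catenary or on a vertical line (`IsSingularArc.normalForm_real`), and therefore
generates a minimal surface. Hence the Willmore integrand of `c` is the derivative of `sin θ_g -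
sin θ_c`, where `θ_g` and `θ_c` are the tangent angles. At the end `sin θ_g → 1` and `sin θ_c →
-1`; at the start `sin θ_c = 0`, and `sin θ_g` is read off from the differential of the inversion.
So each arc contributes `2π (2 - sin θ_g(0))`, and each of the hemispherical caps `2π`. For `x =
∞` the arcs are halves of catenaries and contribute nothing.

All surfaces with `x` real have finite area and so density zero at infinity
(`IsSingularArc.hausdorffMeasure_lt_top`). For `x = ∞` the area of a half catenoid in a large ball
is bounded below by projecting it along the axis, and above by writing it as the graph of a
function with a small Lipschitz constant; this gives density one for each half
(`densityAtInfinity_union_halfCatenoids`).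

A curve with end `x` exists when there is a catenary or a vertical line that starts with the data
transformed by the inversion and runs off to infinity. This fails only if the transformed
direction is vertically downwards, that is, if `x` is the end point of the half circle that leaves
in the opposite direction. The asymptotic bound is elementary from the energy formula.
-/

noncomputable section

/-! ### The Willmore integrand of a surface of revolution -/

theorem hasDerivAt_vec3 {f g h : ℝ → ℝ} {f' g' h' u : ℝ} (hf : HasDerivAt f f' u)
    (hg : HasDerivAt g g' u) (hh : HasDerivAt h h' u) :
    HasDerivAt (fun u => (!₂[f u, g u, h u] : E3)) !₂[f', g', h'] u := by
  have := (PiLp.hasFDerivAt_toLp 2 (𝕜 := ℝ) (E := fun _ : Fin 3 => ℝ)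
    ![f u, g u, h u]).comp_hasDerivAt u
    (f := fun u => ![f u, g u, h u]) (f' := ![f', g', h']) (by
      rw [hasDerivAt_pi]; intro i; fin_cases i <;> simpa)
  exact this

theorem hasDerivAt_re {γ : ℝ → ℂ} {v : ℂ} {u : ℝ} (h : HasDerivAt γ v u) :
    HasDerivAt (fun u => (γ u).re) v.re u :=
  Complex.reCLM.hasFDerivAt.comp_hasDerivAt u h

theorem hasDerivAt_im {γ : ℝ → ℂ} {v : ℂ} {u : ℝ} (h : HasDerivAt γ v u) :
    HasDerivAt (fun u => (γ u).im) v.im u :=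
  Complex.imCLM.hasFDerivAt.comp_hasDerivAt u h

/-- The Willmore integrand `H² √(det) / 4` of a surface of revolution, in terms of the position `z`,
velocity `v` and acceleration `a` of the profile curve. The two terms in the bracket are the
principal curvatures, with a sign that does not matter after squaring. -/
def revIntegrand (z v a : ℂ) : ℝ :=
  1 / 4 * (v.re / (z.im * ‖v‖) - (a.im * v.re - a.re * v.im) / ‖v‖ ^ 3) ^ 2 * (‖v‖ * z.im)

theorem inner_vec3 (a b c a' b' c' : ℝ) :
    inner ℝ (!₂[a, b, c] : E3) !₂[a', b', c'] = a * a' + b * b' + c * c' := by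
  simp [PiLp.inner_apply, Fin.sum_univ_three]
  ring

theorem norm_vec3 (a b c : ℝ) : ‖(!₂[a, b, c] : E3)‖ = √(a ^ 2 + b ^ 2 + c ^ 2) := by
  simp [EuclideanSpace.norm_eq, Fin.sum_univ_three]

theorem cross3_vec3 (a b c a' b' c' : ℝ) :
    cross3 !₂[a, b, c] !₂[a', b', c'] =
      !₂[b * c' - c * b', c * a' - a * c', a * b' - b * a'] := by
  simp [cross3, cross_apply]

theorem smul_vec3 (k a b c : ℝ) : k • (!₂[a, b, c] : E3) = !₂[k * a, k * b, k * c] := by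
  ext i; fin_cases i <;> simp

/-- The Willmore integrand of the parametrised surface in `ℝ³` is `revIntegrand`, for every angle
`φ`. The hypotheses on `γ` are only needed near `s`. -/
theorem revParam_integrand {γ γ1 : ℝ → ℂ} {a : ℂ} {s : ℝ}
    (h1 : ∀ᶠ u in 𝓝 s, HasDerivAt γ (γ1 u) u) (h2 : HasDerivAt γ1 a s)
    (hv : γ1 s ≠ 0) (hy : 0 < (γ s).im) (φ : ℝ) :
    1 / 4 * ParamSurface.meanCurvature (revParam γ) s φ ^ 2
      * √(ParamSurface.metricDet (revParam γ) s φ) = revIntegrand (γ s) (γ1 s) a := by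
  open ParamSurface in
  have D1 : ∀ ψ, ∀ᶠ u in 𝓝 s, d1 (revParam γ) u ψ =
      !₂[(γ1 u).re, (γ1 u).im * Real.cos ψ, (γ1 u).im * Real.sin ψ] := by
    intro ψ
    filter_upwards [h1] with u hu
    exact (hasDerivAt_vec3 (hasDerivAt_re hu) ((hasDerivAt_im hu).mul_const _)
      ((hasDerivAt_im hu).mul_const _)).deriv
  have D2 : ∀ u ψ, d2 (revParam γ) u ψ =
      !₂[0, (γ u).im * -Real.sin ψ, (γ u).im * Real.cos ψ] := by
    intro u ψ
    exact (hasDerivAt_vec3 (hasDerivAt_const _ _) ((Real.hasDerivAt_cos ψ).const_mul _)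
      ((Real.hasDerivAt_sin ψ).const_mul _)).deriv
  have D11 : d1 (d1 (revParam γ)) s φ = !₂[a.re, a.im * Real.cos φ, a.im * Real.sin φ] := by
    refine HasDerivAt.deriv (HasDerivAt.congr_of_eventuallyEq ?_ (D1 φ))
    exact hasDerivAt_vec3 (hasDerivAt_re h2) ((hasDerivAt_im h2).mul_const _)
      ((hasDerivAt_im h2).mul_const _)
  have D22 : d2 (d2 (revParam γ)) s φ =
      !₂[0, (γ s).im * -Real.cos φ, (γ s).im * -Real.sin φ] := by
    have : (fun v => d2 (revParam γ) s v) =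
      fun v => !₂[0, (γ s).im * -Real.sin v, (γ s).im * Real.cos v] := funext fun v => D2 s v
    rw [d2, this]
    exact (hasDerivAt_vec3 (hasDerivAt_const _ _) ((Real.hasDerivAt_sin φ).neg.const_mul _)
      ((Real.hasDerivAt_cos φ).const_mul _)).deriv
  have D1s := (D1 φ).self_of_nhds
  have cs := Real.sin_sq_add_cos_sq φ
  have hN : ‖γ1 s‖ ^ 2 = (γ1 s).re ^ 2 + (γ1 s).im ^ 2 := by
    rw [Complex.sq_norm, Complex.normSq_apply]; ring
  have hNp : 0 < ‖γ1 s‖ := norm_pos_iff.mpr hv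
  have hE : coeffE (revParam γ) s φ = ‖γ1 s‖ ^ 2 := by
    rw [coeffE, D1s, inner_vec3, hN]; linear_combination (γ1 s).im ^ 2 * cs
  have hF : coeffF (revParam γ) s φ = 0 := by
    rw [coeffF, D1s, D2, inner_vec3]; ring
  have hG : coeffG (revParam γ) s φ = (γ s).im ^ 2 := by
    rw [coeffG, D2, inner_vec3]; linear_combination (γ s).im ^ 2 * cs
  have hn : unitNormal (revParam γ) s φ = !₂[(γ1 s).im / ‖γ1 s‖,
      -((γ1 s).re / ‖γ1 s‖ * Real.cos φ), -((γ1 s).re / ‖γ1 s‖ * Real.sin φ)] := by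
    have hc : cross3 (d1 (revParam γ) s φ) (d2 (revParam γ) s φ) =
        !₂[(γ s).im * (γ1 s).im, -((γ s).im * (γ1 s).re * Real.cos φ),
          -((γ s).im * (γ1 s).re * Real.sin φ)] := by
      rw [D1s, D2, cross3_vec3]
      congr 2
      · linear_combination (γ s).im * (γ1 s).im * cs
      congr 1
      · ring
      congr 1
      ring
    have hnorm : ‖cross3 (d1 (revParam γ) s φ) (d2 (revParam γ) s φ)‖ = (γ s).im * ‖γ1 s‖ := by
      rw [hc, norm_vec3, Real.sqrt_eq_iff_mul_self_eq (by positivity) (by positivity)]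
      linear_combination (γ s).im ^ 2 * (γ1 s).re ^ 2 * cs - (γ s).im ^ 2 * hN
    rw [unitNormal, hnorm, hc, smul_vec3]
    congr 2
    · field_simp
    congr 1
    · field_simp
    congr 1
    field_simp
  have hL : coeffL (revParam γ) s φ =
      (a.re * (γ1 s).im - a.im * (γ1 s).re) / ‖γ1 s‖ := by
    rw [coeffL, D11, hn, inner_vec3]
    linear_combination (- a.im * (γ1 s).re / ‖γ1 s‖) * cs
  have hNN : coeffN (revParam γ) s φ = (γ s).im * (γ1 s).re / ‖γ1 s‖ := by
    rw [coeffN, D22, hn, inner_vec3]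
    linear_combination ((γ s).im * (γ1 s).re / ‖γ1 s‖) * cs
  have hdet : metricDet (revParam γ) s φ = (‖γ1 s‖ * (γ s).im) ^ 2 := by
    rw [metricDet, hE, hF, hG]; ring
  rw [meanCurvature, hdet, hE, hF, hG, hL, hNN, Real.sqrt_sq (by positivity), revIntegrand]
  congr 3
  field_simp
  ring

/-- The sine of the angle between `v` and the positive real axis. -/
def sinDir (v : ℂ) : ℝ := v.im / ‖v‖

theorem sq_norm_eq (v : ℂ) : ‖v‖ ^ 2 = v.re ^ 2 + v.im ^ 2 := by
  rw [Complex.sq_norm, Complex.normSq_apply]; ring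

/-- The derivative of `sinDir` along a curve with velocity `v` and acceleration `a`. -/
def sinDirDeriv (v a : ℂ) : ℝ := (a.im * v.re - a.re * v.im) * v.re / ‖v‖ ^ 3

theorem hasDerivAt_sinDir {v : ℝ → ℂ} {a : ℂ} {s : ℝ} (h : HasDerivAt v a s) (hv : v s ≠ 0) :
    HasDerivAt (fun u => sinDir (v u)) (sinDirDeriv (v s) a) s := by
  have hp : 0 < (v s).re ^ 2 + (v s).im ^ 2 := by
    rw [← sq_norm_eq]; exact pow_pos (norm_pos_iff.mpr hv) 2
  have hn : ∀ w : ℂ, ‖w‖ = √(w.re ^ 2 + w.im ^ 2) := fun w => by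
    rw [← sq_norm_eq, Real.sqrt_sq (norm_nonneg _)]
  have h3 := (hasDerivAt_im h).div ((((hasDerivAt_re h).pow 2).add
    ((hasDerivAt_im h).pow 2)).sqrt hp.ne') (Real.sqrt_pos.mpr hp).ne'
  simp only [sinDir, hn, sinDirDeriv]
  refine h3.congr_deriv ?_
  have hs := Real.sq_sqrt hp.le
  have hsp := Real.sqrt_pos.mpr hp
  simp only [Pi.add_apply, Pi.pow_apply] at *
  set r := √((v s).re ^ 2 + (v s).im ^ 2)
  field_simp
  simp only [hs]
  ring

/-- A quarter of the squared hyperbolic curvature times the hyperbolic length element of a curve in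
the upper half plane. -/
def hypIntegrand (z v a : ℂ) : ℝ :=
  1 / 4 * ((a.im * v.re - a.re * v.im) / ‖v‖ ^ 2 + v.re / z.im) ^ 2 * (z.im / ‖v‖)

/-- The Willmore integrand and the hyperbolic elastic integrand differ by a total derivative. -/
theorem revIntegrand_add_sinDirDeriv {z v : ℂ} (a : ℂ) (hz : 0 < z.im) (hv : v ≠ 0) :
    revIntegrand z v a + sinDirDeriv v a = hypIntegrand z v a := by
  have := norm_pos_iff.mpr hv
  rw [revIntegrand, sinDirDeriv, hypIntegrand]
  field_simp
  ring

theorem im_neg_inv (w : ℂ) : (-1 / w).im = w.im / ‖w‖ ^ 2 := by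
  rw [Complex.sq_norm, neg_div, one_div, Complex.neg_im, Complex.inv_im]; ring

/-- The hyperbolic integrand is invariant under the isometry `T z = -1 / (z - x)`; the arguments on
the left are the position, velocity and acceleration of `T ∘ c`. -/
theorem hypIntegrand_neg_inv {z v a : ℂ} (x : ℝ) (hz : 0 < z.im) (hv : v ≠ 0) :
    hypIntegrand (-1 / (z - x)) (v / (z - x) ^ 2)
      (a / (z - x) ^ 2 - 2 * v ^ 2 / (z - x) ^ 3) = hypIntegrand z v a := by
  have curv : ∀ v a : ℂ, (a.im * v.re - a.re * v.im) / ‖v‖ ^ 2 = (a / v).im := by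
    intro v a
    rw [Complex.sq_norm, Complex.div_im]; ring
  have hw : z - x ≠ 0 := by
    intro h
    have := congrArg Complex.im h
    simp at this; linarith
  have hwp := norm_pos_iff.mpr hw
  have hvp := norm_pos_iff.mpr hv
  simp only [hypIntegrand, curv]
  have e1 : (a / (z - x) ^ 2 - 2 * v ^ 2 / (z - x) ^ 3) / (v / (z - x) ^ 2)
      = a / v - 2 * (v / (z - x)) := by
    field_simp
  have e2 : (-1 / (z - x)).im = z.im / ‖z - x‖ ^ 2 := by
    rw [im_neg_inv]; simp
  have e3 : (v / (z - x) ^ 2).re = ((v / (z - x)).re * (z.re - x) + (v / (z - x)).im * z.im)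
      / ‖z - x‖ ^ 2 := by
    rw [sq, ← div_div, Complex.div_re (v / (z - x)), Complex.sq_norm]; simp; ring
  have e4 : v.re = (v / (z - x)).re * (z.re - x) - (v / (z - x)).im * z.im := by
    conv_lhs => rw [← div_mul_cancel₀ v hw]
    simp [Complex.mul_re]
  have e5 : ‖v / (z - x) ^ 2‖ = ‖v‖ / ‖z - x‖ ^ 2 := by simp
  rw [e1, e2, e3, e5, Complex.sub_im]
  rw [e4]
  have : (2 * (v / (z - x))).im = 2 * (v / (z - x)).im := by simp
  rw [this]
  generalize (v / (z - x)) = u at *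
  field_simp
  ring

theorem revIntegrand_neg (z v a : ℂ) : revIntegrand z (-v) a = revIntegrand z v a := by
  simp only [revIntegrand, Complex.neg_re, Complex.neg_im, norm_neg]
  ring

theorem revIntegrand_nonneg {z : ℂ} (v a : ℂ) (hz : 0 ≤ z.im) : 0 ≤ revIntegrand z v a := by
  unfold revIntegrand; positivity

/-- If the Willmore integrand over `I'` has the antiderivative `F`, then integrating out the angle
leaves the integral of `F'`. Taking a genuine `deriv` makes the integrand measurable for free. -/
theorem revWillmore_eq_lintegral_deriv {γ : ℝ → ℂ} {I I' : Set ℝ} {F : ℝ → ℝ}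
    (hI' : MeasurableSet I') (hII' : I =ᵐ[volume] I')
    (h : ∀ s ∈ I', ∀ φ, 1 / 4 * ParamSurface.meanCurvature (revParam γ) s φ ^ 2
      * √(ParamSurface.metricDet (revParam γ) s φ) = deriv F s) :
    revWillmore γ I = ENNReal.ofReal (2 * π) * ∫⁻ s in I', ENNReal.ofReal (deriv F s) := by
  have e : (volume : Measure (ℝ × ℝ)).restrict (I ×ˢ Ioc 0 (2 * π))
      = (volume.restrict I').prod (volume.restrict (Ioc 0 (2 * π))) := by
    rw [← Measure.restrict_congr_set hII', Measure.prod_restrict, Measure.volume_eq_prod]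
  have h2 : ∀ᵐ p ∂((volume.restrict I').prod (volume.restrict (Ioc 0 (2 * π)))),
      ENNReal.ofReal (1 / 4 * ParamSurface.meanCurvature (revParam γ) p.1 p.2 ^ 2
      * √(ParamSurface.metricDet (revParam γ) p.1 p.2)) = ENNReal.ofReal (deriv F p.1) * 1 := by
    rw [Measure.prod_restrict]
    filter_upwards [ae_restrict_mem (hI'.prod measurableSet_Ioc)] with p hp
    rw [h p.1 hp.1, mul_one]
  rw [revWillmore, ParamSurface.willmore, e, lintegral_congr_ae h2,
    lintegral_prod_mul (f := fun s => ENNReal.ofReal (deriv F s)) (g := fun _ => 1)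
      (measurable_deriv F).ennreal_ofReal.aemeasurable aemeasurable_const]
  simp [mul_comm]

/-- The fundamental theorem of calculus for a nonnegative derivative, with the boundary values
taken as limits. -/
theorem lintegral_deriv_Ioo {F : ℝ → ℝ} {a b A B : ℝ} (hab : a < b)
    (hF : ∀ s ∈ Ioo a b, DifferentiableAt ℝ F s) (h0 : ∀ s ∈ Ioo a b, 0 ≤ deriv F s)
    (hA : Tendsto F (𝓝[>] a) (𝓝 A)) (hB : Tendsto F (𝓝[<] b) (𝓝 B)) :
    ∫⁻ s in Ioo a b, ENNReal.ofReal (deriv F s) = ENNReal.ofReal (B - A) := by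
  have hint : IntegrableOn (deriv F) (Ioc a b) := by
    set G := Function.update (Function.update F a A) b B
    have hG : ∀ x ∈ Ioo a b, HasDerivAt G (deriv F x) x := by
      intro x hx
      refine (hF x hx).hasDerivAt.congr_of_eventuallyEq ?_
      filter_upwards [Ioo_mem_nhds hx.1 hx.2] with y hy
      simp [G, Function.update_of_ne hy.2.ne, Function.update_of_ne hy.1.ne']
    refine intervalIntegral.integrableOn_deriv_of_nonneg (g := G) ?_ hG h0
    exact continuousOn_update_iff.2 ⟨by
      rw [Icc_sdiff_right]
      refine continuousOn_update_iff.2 ⟨?_, ?_⟩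
      · rw [Ico_sdiff_left]
        exact fun x hx => (hF x hx).continuousAt.continuousWithinAt
      · intro _
        rw [Ico_sdiff_left, nhdsWithin_Ioo_eq_nhdsGT hab]
        exact hA, by
      intro _
      rw [Icc_sdiff_right]
      refine (hB.mono_left (nhdsWithin_mono _ fun x hx => hx.2)).congr' ?_
      rw [nhdsWithin_Ico_eq_nhdsLT hab]
      filter_upwards [Ioo_mem_nhdsLT hab] with y hy
      rw [Function.update_of_ne hy.1.ne']⟩
  have h := intervalIntegral.integral_eq_sub_of_hasDerivAt_of_tendsto hab
    (fun x hx => (hF x hx).hasDerivAt)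
    ((intervalIntegrable_iff_integrableOn_Ioc_of_le hab.le).mpr hint) hA hB
  rw [← h, intervalIntegral.integral_of_le hab.le, ← integral_Ioc_eq_integral_Ioo.symm,
    ofReal_integral_eq_lintegral_ofReal]
  · exact hint.mono_set Ioo_subset_Ioc_self
  · filter_upwards [ae_restrict_mem measurableSet_Ioo] with x hx using h0 x hx

/-! ### Arcs of catenaries and vertical lines -/

/-- A regular arc in the upper half plane over `[0, 1)` with velocity `g1` and acceleration `g2`.
Derivatives are taken within `[0, 1)`, so that they are one-sided at `0`. -/
structure RegularArc (g g1 g2 : ℝ → ℂ) : Prop where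
  hasDeriv : ∀ s ∈ Ico (0 : ℝ) 1, HasDerivWithinAt g (g1 s) (Ico 0 1) s
  hasDeriv' : ∀ s ∈ Ico (0 : ℝ) 1, HasDerivWithinAt g1 (g2 s) (Ico 0 1) s
  ne_zero : ∀ s ∈ Ico (0 : ℝ) 1, g1 s ≠ 0
  im_pos : ∀ s ∈ Ico (0 : ℝ) 1, 0 < (g s).im

theorem hasDerivWithinAt_re {γ : ℝ → ℂ} {v : ℂ} {u : ℝ} {S : Set ℝ}
    (h : HasDerivWithinAt γ v S u) : HasDerivWithinAt (fun u => (γ u).re) v.re S u :=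
  Complex.reCLM.hasFDerivAt.comp_hasDerivWithinAt u h

theorem hasDerivWithinAt_im {γ : ℝ → ℂ} {v : ℂ} {u : ℝ} {S : Set ℝ}
    (h : HasDerivWithinAt γ v S u) : HasDerivWithinAt (fun u => (γ u).im) v.im S u :=
  Complex.imCLM.hasFDerivAt.comp_hasDerivWithinAt u h

theorem deriv_eq_of_eqOn_Ico {f h : ℝ → ℝ} {f' h' s : ℝ} (hs : s ∈ Ico (0 : ℝ) 1)
    (hf : HasDerivWithinAt f f' (Ico 0 1) s) (hh : HasDerivWithinAt h h' (Ico 0 1) s)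
    (e : ∀ u ∈ Ico (0 : ℝ) 1, f u = h u) : f' = h' :=
  (uniqueDiffOn_Ico 0 1 s hs).eq_deriv _ hf (hh.congr e (e s hs))

theorem exists_sign_of_ne_zero {f : ℝ → ℝ} (hf : ContinuousOn f (Ico 0 1))
    (h0 : ∀ s ∈ Ico (0 : ℝ) 1, f s ≠ 0) :
    ∃ σ : ℝ, (σ = 1 ∨ σ = -1) ∧ ∀ s ∈ Ico (0 : ℝ) 1, 0 < σ * f s := by
  by_cases hp : ∀ s ∈ Ico (0 : ℝ) 1, 0 < f s
  · exact ⟨1, .inl rfl, fun s hs => by simpa using hp s hs⟩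
  · push Not at hp
    obtain ⟨t, ht, ht'⟩ := hp
    refine ⟨-1, .inr rfl, fun s hs => ?_⟩
    by_contra hcon
    obtain ⟨u, hu, hu0⟩ := isPreconnected_Ico.intermediate_value ht hs hf
      (show (0 : ℝ) ∈ Icc (f t) (f s) from ⟨ht', by linarith⟩)
    exact h0 u hu hu0

theorem monotoneOn_Ico_of_deriv_pos {f f' : ℝ → ℝ}
    (hf : ∀ s ∈ Ico (0 : ℝ) 1, HasDerivWithinAt f (f' s) (Ico 0 1) s)
    (h0 : ∀ s ∈ Ico (0 : ℝ) 1, 0 < f' s) : MonotoneOn f (Ico 0 1) := by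
  refine monotoneOn_of_hasDerivWithinAt_nonneg (convex_Ico 0 1)
    (fun s hs => (hf s hs).continuousWithinAt) (f' := f') ?_ ?_
  · intro s hs
    exact (hf s (interior_subset hs)).mono interior_subset
  · intro s hs
    exact (h0 s (interior_subset hs)).le

theorem tendsto_atTop_of_monotoneOn_Ico {U : ℝ → ℝ} (hU : MonotoneOn U (Ico 0 1))
    (hB : ∀ B : ℝ, ∃ s ∈ Ico (0 : ℝ) 1, B ≤ U s) : Tendsto U (𝓝[<] 1) atTop := by
  refine tendsto_atTop.mpr fun B => ?_
  obtain ⟨s, hs, h⟩ := hB B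
  filter_upwards [Ioo_mem_nhdsLT hs.2] with t ht
  exact h.trans (hU hs ⟨hs.1.trans ht.1.le, ht.2⟩ ht.1.le)

theorem tendsto_cosh_atTop : Tendsto Real.cosh atTop atTop := by
  refine tendsto_atTop_mono (fun U => ?_)
    (Real.tendsto_exp_atTop.atTop_mul_const (show (0 : ℝ) < 1 / 2 by norm_num))
  rw [Real.cosh_eq]
  linarith [Real.exp_pos (-U)]

theorem tendsto_inv_cosh : Tendsto (fun U : ℝ => (Real.cosh U)⁻¹) atTop (𝓝 0) :=
  tendsto_cosh_atTop.inv_tendsto_atTop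

theorem tendsto_tanh : Tendsto (fun U : ℝ => Real.sinh U / Real.cosh U) atTop (𝓝 1) := by
  have h : ∀ U : ℝ, Real.sinh U / Real.cosh U = 1 - Real.exp (-U) * (Real.cosh U)⁻¹ := by
    intro U
    have := Real.cosh_pos U
    field_simp
    rw [← Real.cosh_sub_sinh]; ring
  simp only [h]
  simpa using tendsto_const_nhds.sub
    (Real.tendsto_exp_neg_atTop_nhds_zero.mul tendsto_inv_cosh)

theorem tendsto_id_div_cosh : Tendsto (fun U : ℝ => U / Real.cosh U) atTop (𝓝 0) := by
  have h1 : Tendsto (fun U : ℝ => 2 * (U ^ 1 * Real.exp (-U))) atTop (𝓝 0) := by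
    simpa using (Real.tendsto_pow_mul_exp_neg_atTop_nhds_zero 1).const_mul 2
  refine squeeze_zero' ?_ ?_ h1
  · filter_upwards [eventually_ge_atTop 0] with U hU
    exact div_nonneg hU (Real.cosh_pos U).le
  · filter_upwards [eventually_ge_atTop 0] with U hU
    rw [Real.exp_neg, pow_one, div_le_iff₀ (Real.cosh_pos U), Real.cosh_eq]
    have := Real.exp_pos U
    have := Real.exp_pos (-U)
    have h : 2 * (U * (Real.exp U)⁻¹) * ((Real.exp U + Real.exp (-U)) / 2)
        = U + U * (Real.exp U)⁻¹ * Real.exp (-U) := by field_simp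
    rw [h]
    have : 0 ≤ U * (Real.exp U)⁻¹ * Real.exp (-U) := by positivity
    linarith

theorem tendsto_complex_of_re_im {ι : Type*} {l : Filter ι} {f : ι → ℂ} {z : ℂ}
    (h1 : Tendsto (fun i => (f i).re) l (𝓝 z.re)) (h2 : Tendsto (fun i => (f i).im) l (𝓝 z.im)) :
    Tendsto f l (𝓝 z) := by
  have := ((Complex.continuous_ofReal.tendsto _).comp h1).add
    (((Complex.continuous_ofReal.tendsto _).comp h2).mul_const Complex.I)
  simpa [Function.comp_def, Complex.re_add_im] using this

/-- If `g / r → k i` with `k > 0`, then `g` becomes vertical, whatever the scale `r > 0`. -/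
theorem tendsto_direction {ι : Type*} {l : Filter ι} {g : ι → ℂ} {r : ι → ℝ} {k : ℝ} (hk : 0 < k)
    (hr : ∀ᶠ i in l, 0 < r i) (hre : Tendsto (fun i => (g i).re / r i) l (𝓝 0))
    (him : Tendsto (fun i => (g i).im / r i) l (𝓝 k)) :
    Tendsto (fun i => g i / (‖g i‖ : ℂ)) l (𝓝 Complex.I) := by
  have h1 : Tendsto (fun i => g i / (r i : ℂ)) l (𝓝 (k * Complex.I)) :=
    tendsto_complex_of_re_im (by simpa [Complex.div_ofReal_re] using hre)
      (by simpa [Complex.div_ofReal_im] using him)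
  have h2 := h1.div ((Complex.continuous_ofReal.tendsto _).comp h1.norm)
    (by simp [hk.ne'])
  have e : (k * Complex.I : ℂ) / ((‖(k * Complex.I : ℂ)‖ : ℝ) : ℂ) = Complex.I := by
    have : (k : ℂ) ≠ 0 := by exact_mod_cast hk.ne'
    simp [abs_of_pos hk]
    field_simp
  rw [e] at h2
  refine h2.congr' ?_
  filter_upwards [hr] with i hi
  have : (r i : ℂ) ≠ 0 := by exact_mod_cast hi.ne'
  simp [abs_of_pos hi]
  field_simp

/-- The arc lies on the catenary scaled by `lam` and translated along the axis by `m`, written as a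
graph over the axis. -/
def OnCatenary (lam m : ℝ) (g : ℝ → ℂ) : Prop :=
  ∀ s ∈ Ico (0 : ℝ) 1, (g s).im = lam * Real.cosh (((g s).re - m) / lam)

/-- The arc lies on the vertical line over `m`. -/
def OnVertical (m : ℝ) (g : ℝ → ℂ) : Prop := ∀ s ∈ Ico (0 : ℝ) 1, (g s).re = m

section Catenary

variable {g g1 g2 : ℝ → ℂ} {lam m : ℝ}

theorem RegularArc.catenary_im_deriv (h : RegularArc g g1 g2) (hl : 0 < lam)
    (hc : OnCatenary lam m g) {s : ℝ} (hs : s ∈ Ico (0 : ℝ) 1) :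
    (g1 s).im = Real.sinh (((g s).re - m) / lam) * (g1 s).re := by
  refine deriv_eq_of_eqOn_Ico hs (hasDerivWithinAt_im (h.hasDeriv s hs))
    (HasDerivWithinAt.congr_deriv
    ((((hasDerivWithinAt_re (h.hasDeriv s hs)).sub_const m).div_const lam).cosh.const_mul lam) ?_)
    hc
  field_simp

theorem RegularArc.catenary_im_deriv' (h : RegularArc g g1 g2) (hl : 0 < lam)
    (hc : OnCatenary lam m g) {s : ℝ} (hs : s ∈ Ico (0 : ℝ) 1) :
    (g2 s).im = Real.sinh (((g s).re - m) / lam) * (g2 s).re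
      + Real.cosh (((g s).re - m) / lam) * (g1 s).re ^ 2 / lam := by
  refine deriv_eq_of_eqOn_Ico hs (hasDerivWithinAt_im (h.hasDeriv' s hs))
    (HasDerivWithinAt.congr_deriv
    ((((hasDerivWithinAt_re (h.hasDeriv s hs)).sub_const m).div_const lam).sinh.mul
      (hasDerivWithinAt_re (h.hasDeriv' s hs))) ?_) fun u hu => h.catenary_im_deriv hl hc hu
  field_simp
  ring

theorem RegularArc.catenary_re_ne_zero (h : RegularArc g g1 g2) (hl : 0 < lam)
    (hc : OnCatenary lam m g) {s : ℝ} (hs : s ∈ Ico (0 : ℝ) 1) : (g1 s).re ≠ 0 := by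
  intro h0
  refine h.ne_zero s hs (Complex.ext h0 ?_)
  rw [h.catenary_im_deriv hl hc hs, h0]; simp

theorem RegularArc.catenary_norm (h : RegularArc g g1 g2) (hl : 0 < lam)
    (hc : OnCatenary lam m g) {s : ℝ} (hs : s ∈ Ico (0 : ℝ) 1) :
    ‖g1 s‖ = |(g1 s).re| * Real.cosh (((g s).re - m) / lam) := by
  have hp := Real.cosh_pos (((g s).re - m) / lam)
  rw [← sq_eq_sq₀ (norm_nonneg _) (by positivity), mul_pow, sq_abs, sq_norm_eq,
    h.catenary_im_deriv hl hc hs, Real.cosh_sq]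
  ring

/-- Catenoids are minimal surfaces. -/
theorem RegularArc.catenary_revIntegrand (h : RegularArc g g1 g2) (hl : 0 < lam)
    (hc : OnCatenary lam m g) {s : ℝ} (hs : s ∈ Ico (0 : ℝ) 1) :
    revIntegrand (g s) (g1 s) (g2 s) = 0 := by
  have hn := norm_pos_iff.mpr (h.ne_zero s hs)
  have hsq : ‖g1 s‖ ^ 2 = (g1 s).re ^ 2 * Real.cosh (((g s).re - m) / lam) ^ 2 := by
    rw [h.catenary_norm hl hc hs, mul_pow, sq_abs]
  have hp := Real.cosh_pos (((g s).re - m) / lam)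
  have e : (g1 s).re / ((g s).im * ‖g1 s‖)
      - ((g2 s).im * (g1 s).re - (g2 s).re * (g1 s).im) / ‖g1 s‖ ^ 3 = 0 := by
    rw [h.catenary_im_deriv' hl hc hs, h.catenary_im_deriv hl hc hs, hc s hs,
      pow_succ ‖g1 s‖ 2, hsq]
    have := h.catenary_re_ne_zero hl hc hs
    field_simp
    ring
  rw [revIntegrand, e]; ring

/-- A monotone parameter `U` that controls `‖g‖` on bounded sets is unbounded when `g` runs off to
infinity. -/
theorem exists_le_of_norm_tendsto {U : ℝ → ℝ} (hU : MonotoneOn U (Ico 0 1))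
    (hinf : Tendsto (fun s => ‖g s‖) (𝓝[<] 1) atTop) {b : ℝ → ℝ → ℝ}
    (hb : ∀ s ∈ Ico (0 : ℝ) 1, ∀ A B : ℝ, A ≤ U s → U s ≤ B → ‖g s‖ ≤ b A B) (B : ℝ) :
    ∃ s ∈ Ico (0 : ℝ) 1, B ≤ U s := by
  by_contra! hcon
  obtain ⟨s, h1, h2⟩ := ((hinf.eventually_gt_atTop (b (U 0) B)).and
    (Ioo_mem_nhdsLT (zero_lt_one (α := ℝ)))).exists
  have hs : s ∈ Ico (0 : ℝ) 1 := Ioo_subset_Ico_self h2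
  exact absurd (hb s hs (U 0) B (hU ⟨le_rfl, zero_lt_one⟩ hs hs.1) (hcon s hs).le) h1.not_ge

/-- An arc of a catenary that runs off to infinity does so monotonically in the parameter of the
catenary, in one of the two directions `σ`. -/
theorem RegularArc.catenary_exists_sign (h : RegularArc g g1 g2) (hl : 0 < lam)
    (hc : OnCatenary lam m g) (hinf : Tendsto (fun s => ‖g s‖) (𝓝[<] 1) atTop) :
    ∃ σ : ℝ, (σ = 1 ∨ σ = -1) ∧ (∀ s ∈ Ico (0 : ℝ) 1, 0 < σ * (g1 s).re) ∧
      MonotoneOn (fun s => σ * (((g s).re - m) / lam)) (Ico 0 1) ∧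
      Tendsto (fun s => σ * (((g s).re - m) / lam)) (𝓝[<] 1) atTop := by
  obtain ⟨σ, hσ, hpos⟩ := exists_sign_of_ne_zero
    (fun s hs => (hasDerivWithinAt_re (h.hasDeriv' s hs)).continuousWithinAt)
    (fun s hs => h.catenary_re_ne_zero hl hc hs)
  have hm : MonotoneOn (fun s => σ * (((g s).re - m) / lam)) (Ico 0 1) := by
    refine monotoneOn_Ico_of_deriv_pos (fun s hs =>
      ((((hasDerivWithinAt_re (h.hasDeriv s hs)).sub_const m).div_const lam).const_mul σ)) ?_
    intro s hs
    have := hpos s hs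
    rw [← mul_div_assoc]; positivity
  refine ⟨σ, hσ, hpos, hm, tendsto_atTop_of_monotoneOn_Ico hm
    (exists_le_of_norm_tendsto (g := g) hm hinf
      (b := fun A B => |m| + lam * (|A| + |B|) + lam * Real.cosh (|A| + |B|)) ?_)⟩
  intro s hs A B hA hB
  have hσ1 : |σ| = 1 := by rcases hσ with rfl | rfl <;> simp
  have habs : |((g s).re - m) / lam| ≤ |A| + |B| := by
    have : |σ * (((g s).re - m) / lam)| ≤ |A| + |B| := by
      rw [abs_le]
      constructor <;> linarith [neg_abs_le A, le_abs_self B, abs_nonneg A, abs_nonneg B]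
    rwa [abs_mul, hσ1, one_mul] at this
  have h1 : |(g s).re| ≤ |m| + lam * (|A| + |B|) := by
    have e : (g s).re = m + lam * (((g s).re - m) / lam) := by field_simp; ring
    rw [e]
    refine (abs_add_le _ _).trans ?_
    rw [abs_mul, abs_of_pos hl]
    gcongr
  have h2 : |(g s).im| ≤ lam * Real.cosh (|A| + |B|) := by
    rw [abs_of_pos (h.im_pos s hs), hc s hs]
    gcongr
    rw [Real.cosh_le_cosh]
    exact habs.trans (le_abs_self _)
  exact (Complex.norm_le_abs_re_add_abs_im _).trans (add_le_add h1 h2)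

end Catenary

/-- What the energy computation uses about a profile curve `g` of a catenoid or of a plane that
runs off to infinity: its Willmore integrand vanishes, it does not start vertically downwards, and
at infinity its velocity and its position both become vertical. -/
structure MinimalEnd (g g1 g2 : ℝ → ℂ) : Prop where
  integrand : ∀ s ∈ Ico (0 : ℝ) 1, revIntegrand (g s) (g1 s) (g2 s) = 0
  start : -1 < sinDir (g1 0)
  velocity : Tendsto (fun s => g1 s / (‖g1 s‖ : ℂ)) (𝓝[<] 1) (𝓝 Complex.I)
  position : Tendsto (fun s => g s / (‖g s‖ : ℂ)) (𝓝[<] 1) (𝓝 Complex.I)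

theorem eventually_mem_Ico : ∀ᶠ s in 𝓝[<] (1 : ℝ), s ∈ Ico (0 : ℝ) 1 := by
  filter_upwards [Ioo_mem_nhdsLT (zero_lt_one (α := ℝ))] with s hs
  exact Ioo_subset_Ico_self hs

theorem RegularArc.minimalEnd_of_catenary {g g1 g2 : ℝ → ℂ} {lam m : ℝ}
    (h : RegularArc g g1 g2) (hl : 0 < lam)
    (hc : OnCatenary lam m g) (hinf : Tendsto (fun s => ‖g s‖) (𝓝[<] 1) atTop) :
    MinimalEnd g g1 g2 := by
  obtain ⟨σ, hσ, hpos, -, hU⟩ := h.catenary_exists_sign hl hc hinf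
  refine ⟨fun s hs => h.catenary_revIntegrand hl hc hs, ?_, ?_, ?_⟩
  · have h0 : (0 : ℝ) ∈ Ico (0 : ℝ) 1 := ⟨le_rfl, zero_lt_one⟩
    have hn := norm_pos_iff.mpr (h.ne_zero 0 h0)
    rw [sinDir, lt_div_iff₀ hn]
    have := Complex.abs_im_lt_norm.mpr (h.catenary_re_ne_zero hl hc h0)
    linarith [neg_abs_le (g1 0).im]
  · refine tendsto_direction (r := fun s => ‖g1 s‖) one_pos ?_ ?_ ?_
    · filter_upwards [eventually_mem_Ico] with s hs using norm_pos_iff.mpr (h.ne_zero s hs)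
    · have := (tendsto_inv_cosh.comp hU).const_mul σ
      rw [mul_zero] at this
      refine this.congr' ?_
      filter_upwards [eventually_mem_Ico] with s hs
      have hp := hpos s hs
      rw [h.catenary_norm hl hc hs]
      have := Real.cosh_pos (((g s).re - m) / lam)
      rcases hσ with rfl | rfl
      · have h1 : 0 < (g1 s).re := by linarith
        simp only [Function.comp, one_mul, abs_of_pos h1]
        field_simp
      · have h1 : (g1 s).re < 0 := by linarith
        have h2 := h1.ne
        simp only [Function.comp, neg_mul, one_mul, abs_of_neg h1, Real.cosh_neg]
        field_simp
    · refine (tendsto_tanh.comp hU).congr' ?_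
      filter_upwards [eventually_mem_Ico] with s hs
      have hp := hpos s hs
      rw [h.catenary_norm hl hc hs, h.catenary_im_deriv hl hc hs]
      have := Real.cosh_pos (((g s).re - m) / lam)
      rcases hσ with rfl | rfl
      · have h1 : 0 < (g1 s).re := by linarith
        simp only [Function.comp, one_mul, abs_of_pos h1]
        field_simp
      · have h1 : (g1 s).re < 0 := by linarith
        have h2 := h1.ne
        simp only [Function.comp, neg_mul, one_mul, abs_of_neg h1, Real.cosh_neg, Real.sinh_neg]
        field_simp
  · refine tendsto_direction (r := fun s => Real.cosh (((g s).re - m) / lam)) hl ?_ ?_ ?_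
    · exact .of_forall fun s => Real.cosh_pos _
    · have := ((tendsto_inv_cosh.comp hU).const_mul m).add
        ((tendsto_id_div_cosh.comp hU).const_mul (lam * σ))
      rw [mul_zero, mul_zero, add_zero] at this
      refine this.congr fun s => ?_
      have := Real.cosh_pos (((g s).re - m) / lam)
      rcases hσ with rfl | rfl
      · simp only [Function.comp, one_mul]
        field_simp
        ring
      · simp only [Function.comp, neg_mul, one_mul, Real.cosh_neg]
        field_simp
        ring
    · refine tendsto_const_nhds.congr' ?_
      filter_upwards [eventually_mem_Ico] with s hs
      have := Real.cosh_pos (((g s).re - m) / lam)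
      rw [hc s hs]
      field_simp

theorem RegularArc.minimalEnd_of_vertical {g g1 g2 : ℝ → ℂ} {m : ℝ}
    (h : RegularArc g g1 g2)
    (hc : OnVertical m g) (hinf : Tendsto (fun s => ‖g s‖) (𝓝[<] 1) atTop) :
    MinimalEnd g g1 g2 := by
  have hre1 : ∀ s ∈ Ico (0 : ℝ) 1, (g1 s).re = 0 := fun s hs =>
    deriv_eq_of_eqOn_Ico hs (hasDerivWithinAt_re (h.hasDeriv s hs))
      (hasDerivWithinAt_const _ _ m) hc
  have hre2 : ∀ s ∈ Ico (0 : ℝ) 1, (g2 s).re = 0 := fun s hs =>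
    deriv_eq_of_eqOn_Ico hs (hasDerivWithinAt_re (h.hasDeriv' s hs))
      (hasDerivWithinAt_const _ _ 0) hre1
  obtain ⟨σ, hσ, hpos⟩ := exists_sign_of_ne_zero
    (fun s hs => (hasDerivWithinAt_im (h.hasDeriv' s hs)).continuousWithinAt)
    (fun s hs h0 => h.ne_zero s hs (Complex.ext (hre1 s hs) h0))
  have hm : MonotoneOn (fun s => σ * (g s).im) (Ico 0 1) :=
    monotoneOn_Ico_of_deriv_pos
      (fun s hs => (hasDerivWithinAt_im (h.hasDeriv s hs)).const_mul σ) hpos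
  have hub := exists_le_of_norm_tendsto (g := g) hm hinf (b := fun A B => |m| + (|A| + |B|)) (by
    intro s hs A B hA hB
    have hσ1 : |σ| = 1 := by rcases hσ with rfl | rfl <;> simp
    have habs : |(g s).im| ≤ |A| + |B| := by
      have : |σ * (g s).im| ≤ |A| + |B| := by
        rw [abs_le]
        constructor <;> linarith [neg_abs_le A, le_abs_self B, abs_nonneg A, abs_nonneg B]
      rwa [abs_mul, hσ1, one_mul] at this
    refine (Complex.norm_le_abs_re_add_abs_im _).trans ?_
    rw [hc s hs]
    gcongr)
  have hσ1 : σ = 1 := by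
    rcases hσ with rfl | rfl
    · rfl
    · obtain ⟨s, hs, h1⟩ := hub 0
      linarith [h.im_pos s hs]
  subst hσ1
  simp only [one_mul] at hpos hm hub
  have hU : Tendsto (fun s => (g s).im) (𝓝[<] 1) atTop := tendsto_atTop_of_monotoneOn_Ico hm hub
  have hn : ∀ s ∈ Ico (0 : ℝ) 1, ‖g1 s‖ = (g1 s).im := by
    intro s hs
    rw [← sq_eq_sq₀ (norm_nonneg _) (hpos s hs).le, sq_norm_eq, hre1 s hs]; ring
  refine ⟨?_, ?_, ?_, ?_⟩
  · intro s hs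
    simp [revIntegrand, hre1 s hs, hre2 s hs]
  · have h0 : (0 : ℝ) ∈ Ico (0 : ℝ) 1 := ⟨le_rfl, zero_lt_one⟩
    rw [sinDir, hn 0 h0, div_self (hpos 0 h0).ne']
    norm_num
  · refine tendsto_direction (r := fun s => (g1 s).im) one_pos ?_ ?_ ?_
    · filter_upwards [eventually_mem_Ico] with s hs using hpos s hs
    · refine tendsto_const_nhds.congr' ?_
      filter_upwards [eventually_mem_Ico] with s hs
      rw [hre1 s hs, zero_div]
    · refine tendsto_const_nhds.congr' ?_
      filter_upwards [eventually_mem_Ico] with s hs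
      rw [div_self (hpos s hs).ne']
  · refine tendsto_direction (r := fun s => (g s).im) one_pos ?_ ?_ ?_
    · filter_upwards [eventually_mem_Ico] with s hs using h.im_pos s hs
    · refine (tendsto_const_nhds.div_atTop hU (a := m)).congr' ?_
      filter_upwards [eventually_mem_Ico] with s hs
      rw [hc s hs]
    · refine tendsto_const_nhds.congr' ?_
      filter_upwards [eventually_mem_Ico] with s hs
      rw [div_self (h.im_pos s hs).ne']

/-! ### Normal form and antiderivative for singular arcs -/

theorem moebius_denom_ne_zero {a b c d : ℝ} (h : 0 < a * d - b * c) {z : ℂ} (hz : 0 < z.im) :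
    (c : ℂ) * z + d ≠ 0 := by
  intro h0
  have h1 := congrArg Complex.im h0
  have h2 := congrArg Complex.re h0
  simp at h1 h2
  rcases h1 with h1 | h1
  · subst h1
    simp at h2
    subst h2
    simp at h
  · exact hz.ne' h1

theorem moebius_im_pos {a b c d : ℝ} (h : 0 < a * d - b * c) {z : ℂ} (hz : 0 < z.im) :
    0 < (((a : ℂ) * z + b) / (c * z + d)).im := by
  have h1 := moebius_denom_ne_zero h hz
  have e : (((a : ℂ) * z + b) / (c * z + d)).im
      = (a * d - b * c) * z.im / Complex.normSq (c * z + d) := by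
    rw [Complex.div_im]
    simp
    ring
  rw [e]
  have := Complex.normSq_pos.mpr h1
  positivity

section SingularArc

variable {x₀ α₀ β₀ : ℝ} {c : ℝ → ℂ}

theorem IsSingularArc.im_pos {x : OnePoint ℝ} (h : IsSingularArc x₀ α₀ β₀ x c) {s : ℝ}
    (hs : s ∈ Ico (0 : ℝ) 1) : 0 < (c s).im := by
  rcases h.shape with ⟨a, b, c', d, hd, hc⟩ | ⟨m, r, hr, hc⟩
  · obtain ⟨t, ht⟩ := hc s hs
    rw [← ht]
    exact moebius_im_pos hd (Real.cosh_pos t)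
  · exact (hc s hs).1

theorem IsSingularArc.regularArc {x : OnePoint ℝ} (h : IsSingularArc x₀ α₀ β₀ x c) :
    RegularArc c (derivWithin c (Ico 0 1)) (derivWithin (derivWithin c (Ico 0 1)) (Ico 0 1)) where
  hasDeriv s hs := ((h.smooth.differentiableOn (by simp)) s hs).hasDerivWithinAt
  hasDeriv' s hs := by
    have h1 : ContDiffOn ℝ ∞ (derivWithin c (Ico 0 1)) (Ico 0 1) :=
      h.smooth.derivWithin (uniqueDiffOn_Ico 0 1) (by simp)
    exact ((h1.differentiableOn (by simp)) s hs).hasDerivWithinAt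
  ne_zero := h.regular
  im_pos s hs := h.im_pos hs

theorem sub_ofReal_ne_zero {z : ℂ} (hz : 0 < z.im) (x : ℝ) : z - x ≠ 0 := by
  intro h
  have := congrArg Complex.im h
  simp at this
  exact hz.ne' this

/-- The image of a regular arc under the inversion `z ↦ -1 / (z - x)`. -/
theorem RegularArc.inversion {c1 c2 : ℝ → ℂ} (h : RegularArc c c1 c2) (x : ℝ) :
    RegularArc (fun s => -1 / (c s - x)) (fun s => c1 s / (c s - x) ^ 2)
      (fun s => c2 s / (c s - x) ^ 2 - 2 * c1 s ^ 2 / (c s - x) ^ 3) where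
  hasDeriv s hs := by
    have hw := sub_ofReal_ne_zero (h.im_pos s hs) x
    have := (hasDerivWithinAt_const s (Ico (0 : ℝ) 1) (-1 : ℂ)).div
      ((h.hasDeriv s hs).sub_const (x : ℂ)) hw
    refine this.congr_deriv ?_
    simp
  hasDeriv' s hs := by
    have hw := sub_ofReal_ne_zero (h.im_pos s hs) x
    have := (h.hasDeriv' s hs).div (((h.hasDeriv s hs).sub_const (x : ℂ)).pow 2)
      (pow_ne_zero 2 hw)
    refine this.congr_deriv ?_
    simp only [Pi.pow_apply]
    field_simp
    norm_num
    ring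
  ne_zero s hs := div_ne_zero (h.ne_zero s hs)
    (pow_ne_zero 2 (sub_ofReal_ne_zero (h.im_pos s hs) x))
  im_pos s hs := by
    have hw := sub_ofReal_ne_zero (h.im_pos s hs) x
    rw [im_neg_inv]
    have := norm_pos_iff.mpr hw
    have := h.im_pos s hs
    rw [Complex.sub_im, Complex.ofReal_im, sub_zero]
    positivity

/-- The catenary stays away from the axis. This is why only the point `∞` of the catenary can be
sent to the boundary point at which a singular arc ends. -/
theorem not_tendsto_ofReal_of_one_le_im {z : ℝ → ℂ} {y : ℝ}
    (hz : ∀ s ∈ Ico (0 : ℝ) 1, 1 ≤ (z s).im) : ¬ Tendsto z (𝓝[<] 1) (𝓝 (y : ℂ)) := by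
  intro h
  have h1 := (Complex.continuous_im.tendsto _).comp h
  have h2 : (1 : ℝ) ≤ ((y : ℂ)).im := by
    refine ge_of_tendsto h1 ?_
    filter_upwards [eventually_mem_Ico] with s hs using hz s hs
  simp at h2
  linarith

/-- The inversion at the end point `x` turns a singular arc into a piece of a scaled and translated
catenary or of a vertical line. The half circle of the second case is kept for the area bound. -/
theorem IsSingularArc.normalForm_real {x : ℝ} (h : IsSingularArc x₀ α₀ β₀ (x : OnePoint ℝ) c) :
    (∃ lam m : ℝ, 0 < lam ∧ OnCatenary lam m fun s => -1 / (c s - x)) ∨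
      ((∃ m : ℝ, OnVertical m fun s => -1 / (c s - x)) ∧
        ∃ m r : ℝ, 0 < r ∧ ∀ s ∈ Ico (0 : ℝ) 1, c s ∈ halfCircle m r) := by
  have hlim := h.tendsto_real x rfl
  rcases h.shape with ⟨a, b, c', d, hd, hc⟩ | ⟨m, r, hr, hc⟩
  · left
    choose! t ht using hc
    set z : ℝ → ℂ := fun s => ⟨t s, Real.cosh (t s)⟩ with hzdef
    have hz : ∀ s, 1 ≤ (z s).im := fun s => Real.one_le_cosh _
    have key : ∀ s ∈ Ico (0 : ℝ) 1, z s * (c' * c s - a) = b - d * c s := by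
      intro s hs
      have hden := moebius_denom_ne_zero hd (lt_of_lt_of_le one_pos (hz s))
      have h1 : c s = (a * z s + b) / (c' * z s + d) := (ht s hs).symm
      rw [eq_div_iff hden] at h1
      linear_combination h1
    have hx : c' * x = a := by
      by_contra hne
      have hne' : (c' * x - a : ℂ) ≠ 0 := by
        intro h0; apply hne; exact_mod_cast sub_eq_zero.mp h0
      have l1 : Tendsto (fun s => (c' * c s - a : ℂ)) (𝓝[<] 1) (𝓝 (c' * x - a)) :=
        (hlim.const_mul _).sub_const _
      have l2 : Tendsto (fun s => (b - d * c s : ℂ)) (𝓝[<] 1) (𝓝 (b - d * x)) :=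
        (hlim.const_mul _).const_sub _
      refine not_tendsto_ofReal_of_one_le_im (z := z) (y := (b - d * x) / (c' * x - a))
        (fun s _ => hz s) ?_
      push_cast
      refine (l2.div l1 hne').congr' ?_
      filter_upwards [eventually_mem_Ico, l1.eventually_ne hne'] with s hs hs'
      rw [Pi.div_apply, div_eq_iff hs', key s hs]
    have hp : 0 < c' * (x * d - b) := by rw [← hx] at hd; linarith
    have hq : x * d - b ≠ 0 := fun h0 => by simp [h0] at hp
    have hlam : 0 < c' / (x * d - b) := by
      have : c' / (x * d - b) = c' * (x * d - b) / (x * d - b) ^ 2 := by field_simp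
      rw [this]; positivity
    refine ⟨c' / (x * d - b), d / (x * d - b), hlam, fun s hs => ?_⟩
    have hg : -1 / (c s - x)
        = ((c' / (x * d - b) : ℝ) : ℂ) * z s + ((d / (x * d - b) : ℝ) : ℂ) := by
      have hw := sub_ofReal_ne_zero (h.im_pos hs) x
      have hqc : (x * d - b : ℂ) ≠ 0 := by exact_mod_cast hq
      have hxc : (c' * x : ℂ) = a := by exact_mod_cast hx
      have := key s hs
      rw [← hxc] at this
      push_cast
      field_simp
      linear_combination -this
    have e1 : (-1 / (c s - x)).im = c' / (x * d - b) * Real.cosh (t s) := by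
      rw [hg, Complex.add_im, Complex.im_ofReal_mul, Complex.ofReal_im, add_zero]
    have e2 : (-1 / (c s - x)).re = c' / (x * d - b) * t s + d / (x * d - b) := by
      rw [hg, Complex.add_re, Complex.re_ofReal_mul, Complex.ofReal_re]
    rw [e1, e2, add_sub_cancel_right, mul_div_cancel_left₀ _ hlam.ne']
  · right
    have hm : (x - m) ^ 2 = r ^ 2 := by
      have l1 : Tendsto (fun s => ((c s).re - m) ^ 2 + (c s).im ^ 2) (𝓝[<] 1)
          (𝓝 (((x : ℂ).re - m) ^ 2 + (x : ℂ).im ^ 2)) :=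
        ((((Complex.continuous_re.tendsto _).comp hlim).sub_const m).pow 2).add
          (((Complex.continuous_im.tendsto _).comp hlim).pow 2)
      have l2 : Tendsto (fun s => ((c s).re - m) ^ 2 + (c s).im ^ 2) (𝓝[<] 1) (𝓝 (r ^ 2)) := by
        refine tendsto_const_nhds.congr' ?_
        filter_upwards [eventually_mem_Ico] with s hs using ((hc s hs).2).symm
      simpa using tendsto_nhds_unique l1 l2
    have hxm : x - m ≠ 0 := by
      intro h0
      rw [h0] at hm
      have : 0 < r ^ 2 := by positivity
      simp at hm
      exact this.ne hm
    refine ⟨⟨1 / (2 * (x - m)), fun s hs => ?_⟩, m, r, hr, hc⟩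
    have hw := Complex.normSq_pos.mpr (sub_ofReal_ne_zero (h.im_pos hs) x)
    have hcs := (hc s hs).2
    change (-1 / (c s - x)).re = _
    rw [neg_div, one_div, Complex.neg_re, Complex.inv_re, ← neg_div,
      div_eq_div_iff hw.ne' (by simpa using hxm)]
    rw [Complex.normSq_apply]
    simp
    linear_combination hm - hcs

/-- A singular arc with end point `∞` is a piece of a scaled and translated catenary; half circles
are bounded. -/
theorem IsSingularArc.normalForm_infty (h : IsSingularArc x₀ α₀ β₀ OnePoint.infty c) :
    ∃ lam m : ℝ, 0 < lam ∧ OnCatenary lam m c := by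
  have hlim := h.tendsto_infty rfl
  rcases h.shape with ⟨a, b, c', d, hd, hc⟩ | ⟨m, r, hr, hc⟩
  · choose! t ht using hc
    set z : ℝ → ℂ := fun s => ⟨t s, Real.cosh (t s)⟩ with hzdef
    have hz : ∀ s, 1 ≤ (z s).im := fun s => Real.one_le_cosh _
    have key : ∀ s ∈ Ico (0 : ℝ) 1, z s * (c' * c s - a) = b - d * c s := by
      intro s hs
      have hden := moebius_denom_ne_zero hd (lt_of_lt_of_le one_pos (hz s))
      have h1 : c s = (a * z s + b) / (c' * z s + d) := (ht s hs).symm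
      rw [eq_div_iff hden] at h1
      linear_combination h1
    have hx : c' = 0 := by
      by_contra hne
      have hne' : (c' - a * 0 : ℂ) ≠ 0 := by simpa using hne
      have l0 : Tendsto (fun s => (c s)⁻¹) (𝓝[<] 1) (𝓝 0) :=
        tendsto_inv₀_cobounded.comp (tendsto_norm_atTop_iff_cobounded.mp hlim)
      have l1 : Tendsto (fun s => (c' - a * (c s)⁻¹ : ℂ)) (𝓝[<] 1) (𝓝 (c' - a * 0)) :=
        (l0.const_mul _).const_sub _
      have l2 : Tendsto (fun s => (b * (c s)⁻¹ - d : ℂ)) (𝓝[<] 1) (𝓝 (b * 0 - d)) :=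
        (l0.const_mul _).sub_const _
      refine not_tendsto_ofReal_of_one_le_im (z := z) (y := (b * 0 - d) / (c' - a * 0))
        (fun s _ => hz s) ?_
      push_cast
      refine (l2.div l1 hne').congr' ?_
      filter_upwards [eventually_mem_Ico, l1.eventually_ne hne'] with s hs hs'
      have h0 : c s ≠ 0 := fun h0 => by simpa [h0] using h.im_pos hs
      rw [Pi.div_apply, div_eq_iff hs']
      have := key s hs
      field_simp
      linear_combination -this
    subst hx
    have hd0 : d ≠ 0 := fun h0 => by simp [h0] at hd
    have hlam : 0 < a / d := by
      have : a / d = (a * d) / d ^ 2 := by field_simp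
      rw [this]
      have : 0 < a * d := by linarith
      positivity
    refine ⟨a / d, b / d, hlam, fun s hs => ?_⟩
    have hg : c s = ((a / d : ℝ) : ℂ) * z s + ((b / d : ℝ) : ℂ) := by
      have hdc : (d : ℂ) ≠ 0 := by exact_mod_cast hd0
      have := key s hs
      push_cast at this ⊢
      field_simp
      linear_combination this
    have e1 : (c s).im = a / d * Real.cosh (t s) := by
      rw [hg, Complex.add_im, Complex.im_ofReal_mul, Complex.ofReal_im, add_zero]
    have e2 : (c s).re = a / d * t s + b / d := by
      rw [hg, Complex.add_re, Complex.re_ofReal_mul, Complex.ofReal_re]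
    rw [e1, e2, add_sub_cancel_right, mul_div_cancel_left₀ _ hlam.ne']
  · exfalso
    obtain ⟨s, h1, hs⟩ := ((hlim.eventually_gt_atTop (|m| + r + r)).and eventually_mem_Ico).exists
    have hcs := (hc s hs).2
    have i1 : |(c s).re - m| ≤ r := abs_le_of_sq_le_sq (by nlinarith [sq_nonneg (c s).im]) hr.le
    have i2 : |(c s).im| ≤ r := abs_le_of_sq_le_sq (by nlinarith [sq_nonneg ((c s).re - m)]) hr.le
    have i3 : |(c s).re| ≤ |m| + |(c s).re - m| := by
      simpa using abs_add_le m ((c s).re - m)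
    linarith [Complex.norm_le_abs_re_add_abs_im (c s)]

theorem IsSingularArc.minimalEnd_real {x : ℝ} (h : IsSingularArc x₀ α₀ β₀ (x : OnePoint ℝ) c) :
    MinimalEnd (fun s => -1 / (c s - x)) (fun s => derivWithin c (Ico 0 1) s / (c s - x) ^ 2)
      (fun s => derivWithin (derivWithin c (Ico 0 1)) (Ico 0 1) s / (c s - x) ^ 2
        - 2 * derivWithin c (Ico 0 1) s ^ 2 / (c s - x) ^ 3) := by
  have hreg := h.regularArc.inversion x
  have hlim : Tendsto (fun s => c s - x) (𝓝[<] 1) (𝓝[≠] 0) := by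
    refine tendsto_nhdsWithin_iff.mpr ⟨?_, ?_⟩
    · simpa using (h.tendsto_real x rfl).sub_const (x : ℂ)
    · filter_upwards [eventually_mem_Ico] with s hs using sub_ofReal_ne_zero (h.im_pos hs) x
  have hinf : Tendsto (fun s => ‖-1 / (c s - x)‖) (𝓝[<] 1) atTop := by
    refine ((tendsto_norm_inv_nhdsNE_zero_atTop).comp hlim).congr fun s => ?_
    simp
  rcases h.normalForm_real with ⟨lam, m, hl, hc⟩ | ⟨⟨m, hc⟩, -⟩
  · exact hreg.minimalEnd_of_catenary hl hc hinf
  · exact hreg.minimalEnd_of_vertical hc hinf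

theorem sinDir_eq_im (v : ℂ) : sinDir v = (v / (‖v‖ : ℂ)).im := by
  rw [Complex.div_ofReal_im, sinDir]

theorem sinDir_mul {k : ℝ} (hk : 0 < k) (v : ℂ) : sinDir (k * v) = sinDir v := by
  simp only [sinDir, norm_mul, Complex.im_ofReal_mul, Complex.norm_real,
    Real.norm_eq_abs, abs_of_pos hk]
  rw [mul_div_mul_left _ _ hk.ne']

theorem RegularArc.hasDerivAt {g g1 g2 : ℝ → ℂ} (h : RegularArc g g1 g2) {s : ℝ}
    (hs : s ∈ Ioo (0 : ℝ) 1) : HasDerivAt g (g1 s) s :=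
  (h.hasDeriv s (Ioo_subset_Ico_self hs)).hasDerivAt (Ico_mem_nhds hs.1 hs.2)

theorem RegularArc.hasDerivAt' {g g1 g2 : ℝ → ℂ} (h : RegularArc g g1 g2) {s : ℝ}
    (hs : s ∈ Ioo (0 : ℝ) 1) : HasDerivAt g1 (g2 s) s :=
  (h.hasDeriv' s (Ioo_subset_Ico_self hs)).hasDerivAt (Ico_mem_nhds hs.1 hs.2)

theorem RegularArc.tendsto_sinDir_zero {g g1 g2 : ℝ → ℂ} (h : RegularArc g g1 g2) :
    Tendsto (fun s => sinDir (g1 s)) (𝓝[>] 0) (𝓝 (sinDir (g1 0))) := by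
  have h0 : (0 : ℝ) ∈ Ico (0 : ℝ) 1 := ⟨le_rfl, zero_lt_one⟩
  have h1 : Tendsto g1 (𝓝[>] 0) (𝓝 (g1 0)) := by
    have : Tendsto g1 (𝓝[Ico 0 1] 0) (𝓝 (g1 0)) := (h.hasDeriv' 0 h0).continuousWithinAt
    rw [nhdsWithin_Ico_eq_nhdsGE zero_lt_one] at this
    exact this.mono_left (nhdsWithin_mono _ Ioi_subset_Ici_self)
  exact ((Complex.continuous_im.tendsto _).comp h1).div h1.norm
    (norm_ne_zero_iff.mpr (h.ne_zero 0 h0))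

/-- `F` is an antiderivative over `(0, 1)` of the Willmore integrand of the arc `c`, with boundary
values `A` and `B`. -/
structure WillmorePrimitive (c c1 c2 : ℝ → ℂ) (F : ℝ → ℝ) (A B : ℝ) : Prop where
  arc : RegularArc c c1 c2
  hasDeriv : ∀ s ∈ Ioo (0 : ℝ) 1, HasDerivAt F (revIntegrand (c s) (c1 s) (c2 s)) s
  tendsto_zero : Tendsto F (𝓝[>] 0) (𝓝 A)
  tendsto_one : Tendsto F (𝓝[<] 1) (𝓝 B)

/-- The integrand of `g = -1 / (c - x)` vanishes, so that the one of `c` is the derivative of the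
difference of the sines of the tangent angles of `g` and `c`. At the end `x` these sines tend to
`1` and `-1`. -/
theorem RegularArc.willmorePrimitive {c1 c2 : ℝ → ℂ} (h : RegularArc c c1 c2) (x : ℝ)
    (hm : MinimalEnd (fun s => -1 / (c s - x)) (fun s => c1 s / (c s - x) ^ 2)
      (fun s => c2 s / (c s - x) ^ 2 - 2 * c1 s ^ 2 / (c s - x) ^ 3)) :
    WillmorePrimitive c c1 c2 (fun s => sinDir (c1 s / (c s - x) ^ 2) - sinDir (c1 s))
      (sinDir (c1 0 / (c 0 - x) ^ 2) - sinDir (c1 0)) 2 := by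
  have hg := h.inversion x
  refine ⟨h, ?_, hg.tendsto_sinDir_zero.sub h.tendsto_sinDir_zero, ?_⟩
  · intro s hs
    have hs' := Ioo_subset_Ico_self hs
    refine ((hasDerivAt_sinDir (hg.hasDerivAt' hs) (hg.ne_zero s hs')).sub
      (hasDerivAt_sinDir (h.hasDerivAt' hs) (h.ne_zero s hs'))).congr_deriv ?_
    have e1 := revIntegrand_add_sinDirDeriv (c2 s) (h.im_pos s hs') (h.ne_zero s hs')
    have e2 := revIntegrand_add_sinDirDeriv (c2 s / (c s - x) ^ 2 - 2 * c1 s ^ 2 / (c s - x) ^ 3)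
      (hg.im_pos s hs') (hg.ne_zero s hs')
    have e3 := hm.integrand s hs'
    have e4 := hypIntegrand_neg_inv (a := c2 s) x (h.im_pos s hs') (h.ne_zero s hs')
    linarith
  · have l1 : Tendsto (fun s => sinDir (c1 s / (c s - x) ^ 2)) (𝓝[<] 1) (𝓝 1) := by
      simp only [sinDir_eq_im]
      simpa [Function.comp_def] using (Complex.continuous_im.tendsto _).comp hm.velocity
    have l2 : Tendsto (fun s => sinDir (c1 s)) (𝓝[<] 1) (𝓝 (-1)) := by
      -- Undoing the inversion gives `c' = g' / g²`, and both `g'` and `g` point in direction `i`.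
      have l3 := (Complex.continuous_im.tendsto _).comp
        (hm.velocity.div (hm.position.pow 2) (by simp))
      simp only [sinDir_eq_im]
      have e : (Complex.I / Complex.I ^ 2).im = -1 := by simp [div_neg]
      rw [e] at l3
      refine l3.congr' ?_
      filter_upwards [eventually_mem_Ico] with s hs
      have hw := sub_ofReal_ne_zero (h.im_pos s hs) x
      have hn : (‖c s - x‖ : ℂ) ≠ 0 := by simpa using hw
      have hn1 : (‖c1 s‖ : ℂ) ≠ 0 := by simpa using h.ne_zero s hs
      simp only [Function.comp, Pi.div_apply, norm_div, norm_neg, norm_one, norm_pow]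
      congr 1
      push_cast
      field_simp
    have := l1.sub l2
    norm_num at this
    exact this

end SingularArc

/-! ### Willmore energies of the union curve and of the sphere caps -/

theorem RegularArc.integrand_eq {c c1 c2 : ℝ → ℂ} (h : RegularArc c c1 c2) {s : ℝ}
    (hs : s ∈ Ioo (0 : ℝ) 1) {γ : ℝ → ℂ} (hγ : γ =ᶠ[𝓝 s] c) (φ : ℝ) :
    1 / 4 * ParamSurface.meanCurvature (revParam γ) s φ ^ 2
      * √(ParamSurface.metricDet (revParam γ) s φ) = revIntegrand (c s) (c1 s) (c2 s) := by
  have hs' := Ioo_subset_Ico_self hs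
  rw [revParam_integrand (γ1 := c1) (a := c2 s) ?_ (h.hasDerivAt' hs) (h.ne_zero s hs') ?_,
    hγ.self_of_nhds]
  · filter_upwards [hγ.eventuallyEq_nhds, Ioo_mem_nhds hs.1 hs.2] with u hu hu'
    exact (h.hasDerivAt hu').congr_of_eventuallyEq hu
  · rw [hγ.self_of_nhds]; exact h.im_pos s hs'

/-- The integrand of the arc run backwards over `(1, 2]`, as in `unionCurve`. -/
theorem RegularArc.integrand_reverse_eq {c c1 c2 : ℝ → ℂ} (h : RegularArc c c1 c2) {s : ℝ}
    (hs : s ∈ Ioo (1 : ℝ) 2) {γ : ℝ → ℂ} (hγ : γ =ᶠ[𝓝 s] fun u => c (2 - u)) (φ : ℝ) :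
    1 / 4 * ParamSurface.meanCurvature (revParam γ) s φ ^ 2
      * √(ParamSurface.metricDet (revParam γ) s φ)
      = revIntegrand (c (2 - s)) (c1 (2 - s)) (c2 (2 - s)) := by
  have hmem : ∀ u ∈ Ioo (1 : ℝ) 2, 2 - u ∈ Ioo (0 : ℝ) 1 := fun u hu =>
    ⟨by linarith [hu.2], by linarith [hu.1]⟩
  have hd : ∀ u : ℝ, HasDerivAt (fun u : ℝ => 2 - u) (-1) u := fun u =>
    (hasDerivAt_id u).const_sub 2
  have hs' := Ioo_subset_Ico_self (hmem s hs)
  rw [revParam_integrand (γ1 := fun u => -c1 (2 - u)) (a := c2 (2 - s)) ?_ ?_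
    (neg_ne_zero.mpr (h.ne_zero _ hs')) ?_, hγ.self_of_nhds, revIntegrand_neg]
  · filter_upwards [hγ.eventuallyEq_nhds, Ioo_mem_nhds hs.1 hs.2] with u hu hu'
    refine HasDerivAt.congr_of_eventuallyEq ?_ hu
    simpa [Function.comp_def] using (h.hasDerivAt (hmem u hu')).scomp u (hd u)
  · simpa [Function.comp_def, Pi.neg_def] using ((h.hasDerivAt' (hmem s hs)).scomp s (hd s)).neg
  · rw [hγ.self_of_nhds]; exact h.im_pos _ hs'

theorem WillmorePrimitive.lintegral {c c1 c2 : ℝ → ℂ} {F : ℝ → ℝ} {A B : ℝ}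
    (h : WillmorePrimitive c c1 c2 F A B) :
    ∫⁻ s in Ioo 0 1, ENNReal.ofReal (deriv F s) = ENNReal.ofReal (B - A) := by
  refine lintegral_deriv_Ioo zero_lt_one (fun s hs => (h.hasDeriv s hs).differentiableAt)
    (fun s hs => ?_) h.tendsto_zero h.tendsto_one
  rw [(h.hasDeriv s hs).deriv]
  exact revIntegrand_nonneg _ _ (h.arc.im_pos s (Ioo_subset_Ico_self hs)).le

theorem WillmorePrimitive.lintegral_reverse {c c1 c2 : ℝ → ℂ} {F : ℝ → ℝ} {A B : ℝ}
    (h : WillmorePrimitive c c1 c2 F A B) :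
    ∫⁻ s in Ioo 1 2, ENNReal.ofReal (deriv F (2 - s)) = ENNReal.ofReal (B - A) := by
  rw [← h.lintegral]
  have := (Measure.measurePreserving_sub_left (volume : Measure ℝ) 2).setLIntegral_comp_preimage_emb
    (MeasurableEquiv.subLeft (2 : ℝ)).measurableEmbedding (fun s => ENNReal.ofReal (deriv F s))
    (Ioo 0 1)
  rw [← this]
  congr 2
  ext s
  simp only [mem_preimage, mem_Ioo]
  constructor <;> rintro ⟨h1, h2⟩ <;> constructor <;> linarith

theorem revWillmore_unionCurve {cm cm1 cm2 cp cp1 cp2 : ℝ → ℂ} {Fm Fp : ℝ → ℝ} {Am Bm Ap Bp : ℝ}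
    (hm : WillmorePrimitive cm cm1 cm2 Fm Am Bm) (hp : WillmorePrimitive cp cp1 cp2 Fp Ap Bp) :
    revWillmore (unionCurve cm cp) (Icc 0 2 \ {1})
      = ENNReal.ofReal (2 * π) * (ENNReal.ofReal (Bm - Am) + ENNReal.ofReal (Bp - Ap)) := by
  have hae : (Icc (0 : ℝ) 2 \ {1} : Set ℝ) =ᵐ[volume] (Ioo 0 1 ∪ Ioo 1 2 : Set ℝ) := by
    have h0 : ∀ᵐ s ∂(volume : Measure ℝ), s ≠ 0 ∧ s ≠ 1 ∧ s ≠ 2 := by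
      filter_upwards [Measure.ae_ne volume 0, Measure.ae_ne volume 1, Measure.ae_ne volume 2]
        with s h0 h1 h2 using ⟨h0, h1, h2⟩
    filter_upwards [h0] with s hs
    refine propext ?_
    change (s ∈ Icc (0 : ℝ) 2 \ {1}) ↔ s ∈ Ioo (0 : ℝ) 1 ∪ Ioo 1 2
    simp only [Set.mem_sdiff, mem_Icc, mem_singleton_iff, mem_union, mem_Ioo]
    constructor
    · rintro ⟨⟨h1, h2⟩, h3⟩
      rcases lt_or_gt_of_ne h3 with h | h
      · exact .inl ⟨lt_of_le_of_ne h1 (Ne.symm hs.1), h⟩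
      · exact .inr ⟨h, lt_of_le_of_ne h2 hs.2.2⟩
    · rintro (h | h)
      · exact ⟨⟨by linarith, by linarith⟩, h.2.ne⟩
      · exact ⟨⟨by linarith, by linarith⟩, h.1.ne'⟩
  have nm : ∀ s ∈ Ioo (0 : ℝ) 1, ∀ᶠ u in 𝓝 s, u < 1 := fun s hs => Iio_mem_nhds hs.2
  have np : ∀ s ∈ Ioo (1 : ℝ) 2, ∀ᶠ u in 𝓝 s, ¬ u < 1 := fun s hs => by
    filter_upwards [Ioi_mem_nhds hs.1] with u hu using not_lt.mpr (le_of_lt hu)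
  -- Reversal changes the sign of the antiderivative as well as that of the parameter.
  set F : ℝ → ℝ := fun s => if s < 1 then Fm s else -Fp (2 - s) with hF
  have dm : ∀ s ∈ Ioo (0 : ℝ) 1, deriv F s = deriv Fm s := fun s hs => by
    refine Filter.EventuallyEq.deriv_eq ?_
    filter_upwards [nm s hs] with u hu
    rw [hF]; exact if_pos hu
  have dp : ∀ s ∈ Ioo (1 : ℝ) 2, deriv F s = deriv Fp (2 - s) := fun s hs => by
    have : F =ᶠ[𝓝 s] fun u => -Fp (2 - u) := by
      filter_upwards [np s hs] with u hu
      rw [hF]; exact if_neg hu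
    rw [this.deriv_eq, deriv.fun_neg, deriv_comp_const_sub, neg_neg]
  rw [revWillmore_eq_lintegral_deriv (F := F) (measurableSet_Ioo.union measurableSet_Ioo) hae,
    lintegral_union measurableSet_Ioo]
  · congr 2
    · rw [← hm.lintegral]
      exact setLIntegral_congr_fun measurableSet_Ioo fun s hs => by rw [dm s hs]
    · rw [← hp.lintegral_reverse]
      exact setLIntegral_congr_fun measurableSet_Ioo fun s hs => by rw [dp s hs]
  · rw [Set.disjoint_left]
    intro s h1 h2
    exact absurd h1.2 (not_lt.mpr h2.1.le)
  · rintro s (hs | hs) φ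
    · rw [dm s hs, (hm.hasDeriv s hs).deriv]
      refine hm.arc.integrand_eq hs ?_ φ
      filter_upwards [nm s hs] with u hu using if_pos hu
    · rw [dp s hs, (hp.hasDeriv (2 - s) ⟨by linarith [hs.2], by linarith [hs.1]⟩).deriv]
      refine hp.arc.integrand_reverse_eq hs ?_ φ
      filter_upwards [np s hs] with u hu using if_neg hu

theorem cos_sq_of_sin_eq_zero {β : ℝ} (hβ : Real.sin β = 0) : Real.cos β ^ 2 = 1 := by
  have := Real.sin_sq_add_cos_sq β
  rw [hβ] at this
  linarith

theorem capCurve_of_sin_eq_zero {x₀ α β : ℝ} (hβ : Real.sin β = 0) (t : ℝ) :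
    capCurve x₀ α β t = ⟨x₀ + α * (Real.cos β * Real.sinh t) / Real.cosh t, α / Real.cosh t⟩ := by
  simp [capCurve, hβ]

theorem hasDerivAt_mk {f g : ℝ → ℝ} {f' g' t : ℝ} (hf : HasDerivAt f f' t)
    (hg : HasDerivAt g g' t) : HasDerivAt (fun t => (⟨f t, g t⟩ : ℂ)) ⟨f', g'⟩ t := by
  have e : ∀ a b : ℝ, (⟨a, b⟩ : ℂ) = (a : ℂ) + b * Complex.I := fun a b =>
    Complex.mk_eq_add_mul_I a b
  simp only [e]
  exact hf.ofReal_comp.add (hg.ofReal_comp.mul_const _)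

/-- Each sphere cap is a hemisphere: the integrand is the derivative of `tanh`. -/
theorem revWillmore_capCurve {x₀ α β : ℝ} (hα : 0 < α) (hβ : Real.sin β = 0) :
    revWillmore (capCurve x₀ α β) (Iic 0) = ENNReal.ofReal (2 * π) := by
  have hcos := cos_sq_of_sin_eq_zero hβ
  set e := Real.cos β
  have hc : capCurve x₀ α β = fun t => ⟨x₀ + α * e * (Real.sinh t / Real.cosh t),
      α * (Real.cosh t)⁻¹⟩ := by
    funext t
    rw [capCurve_of_sin_eq_zero hβ]
    congr 1; ring
  have hinv : ∀ t, HasDerivAt (fun t => (Real.cosh t)⁻¹) (-Real.sinh t / Real.cosh t ^ 2) t :=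
    fun t => (Real.hasDerivAt_cosh t).inv (Real.cosh_pos t).ne'
  have htanh : ∀ t, HasDerivAt (fun t => Real.sinh t / Real.cosh t) ((Real.cosh t ^ 2)⁻¹) t := by
    intro t
    refine ((Real.hasDerivAt_sinh t).div (Real.hasDerivAt_cosh t) (Real.cosh_pos t).ne').congr_deriv
      ?_
    have := Real.cosh_pos t
    field_simp
    linarith [Real.cosh_sq t]
  set γ1 : ℝ → ℂ := fun t => ⟨α * e * (Real.cosh t ^ 2)⁻¹,
    α * (-Real.sinh t / Real.cosh t ^ 2)⟩ with hγ1
  have d1 : ∀ t, HasDerivAt (capCurve x₀ α β) (γ1 t) t := by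
    intro t
    rw [hc]
    exact hasDerivAt_mk (((htanh t).const_mul _).const_add _) ((hinv t).const_mul _)
  have d2 : ∀ t, HasDerivAt γ1 ⟨α * e * (-2 * Real.sinh t / Real.cosh t ^ 3),
      α * ((2 * Real.sinh t ^ 2 - Real.cosh t ^ 2) / Real.cosh t ^ 3)⟩ t := by
    intro t
    have := Real.cosh_pos t
    refine hasDerivAt_mk (HasDerivAt.const_mul _ ?_) (HasDerivAt.const_mul _ ?_)
    · refine (((Real.hasDerivAt_cosh t).pow 2).inv (pow_pos this 2).ne').congr_deriv ?_
      simp only [Pi.pow_apply]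
      field_simp
      norm_num
      ring
    · refine ((Real.hasDerivAt_sinh t).neg.div ((Real.hasDerivAt_cosh t).pow 2)
        (pow_pos this 2).ne').congr_deriv ?_
      simp only [Pi.pow_apply, Pi.neg_apply]
      field_simp
      norm_num
      ring
  have hnorm : ∀ t, ‖γ1 t‖ = α / Real.cosh t := by
    intro t
    have := Real.cosh_pos t
    rw [← sq_eq_sq₀ (norm_nonneg _) (by positivity), sq_norm_eq, hγ1]
    simp only
    have := Real.cosh_sq t
    field_simp
    linear_combination hcos - this
  have hI : ∀ t φ, 1 / 4 * ParamSurface.meanCurvature (revParam (capCurve x₀ α β)) t φ ^ 2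
      * √(ParamSurface.metricDet (revParam (capCurve x₀ α β)) t φ)
      = deriv (fun t => Real.sinh t / Real.cosh t) t := by
    intro t φ
    have hp := Real.cosh_pos t
    rw [revParam_integrand (.of_forall d1) (d2 t) ?_ ?_, (htanh t).deriv, revIntegrand, hnorm t, hc,
      hγ1]
    · simp only
      have hs := Real.cosh_sq t
      have e1 : α * e * (Real.cosh t ^ 2)⁻¹ / (α * (Real.cosh t)⁻¹ * (α / Real.cosh t))
        - (α * ((2 * Real.sinh t ^ 2 - Real.cosh t ^ 2) / Real.cosh t ^ 3)
          * (α * e * (Real.cosh t ^ 2)⁻¹) - α * e * (-2 * Real.sinh t / Real.cosh t ^ 3)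
          * (α * (-Real.sinh t / Real.cosh t ^ 2))) / (α / Real.cosh t) ^ 3 = 2 * e / α := by
        field_simp
        ring
      rw [e1]
      field_simp
      linear_combination 4 * hcos
    · rw [← norm_pos_iff, hnorm t]; positivity
    · rw [hc]; simp only; positivity
  rw [revWillmore_eq_lintegral_deriv measurableSet_Iic (Filter.EventuallyEq.refl _ _)
    (F := fun t => Real.sinh t / Real.cosh t) fun t _ φ => hI t φ]
  suffices h : ∫⁻ t in Iic 0, ENNReal.ofReal (deriv (fun t => Real.sinh t / Real.cosh t) t) = 1 by
    rw [h, mul_one]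
  -- The integrand is even, which moves the integral to `(0, ∞)`.
  have heven : ∀ t, deriv (fun t => Real.sinh t / Real.cosh t) (-t)
      = deriv (fun t => Real.sinh t / Real.cosh t) t := by
    intro t
    rw [(htanh t).deriv, (htanh (-t)).deriv, Real.cosh_neg]
  have h1 := (Measure.measurePreserving_neg (volume : Measure ℝ)).setLIntegral_comp_preimage_emb
    (MeasurableEquiv.neg ℝ).measurableEmbedding
    (fun t => ENNReal.ofReal (deriv (fun t => Real.sinh t / Real.cosh t) t)) (Iic 0)
  simp only [heven] at h1
  have hpre : (Neg.neg ⁻¹' Iic (0 : ℝ)) = Ici 0 := by ext t; simp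
  rw [← h1, hpre, setLIntegral_congr Ioi_ae_eq_Ici.symm]
  simp only [fun t => (htanh t).deriv]
  have hpos : ∀ t ∈ Ioi (0 : ℝ), 0 ≤ (Real.cosh t ^ 2)⁻¹ := fun t _ => by
    have := Real.cosh_pos t; positivity
  rw [← ofReal_integral_eq_lintegral_ofReal
    (integrableOn_Ioi_deriv_of_nonneg' (fun t _ => htanh t) hpos tendsto_tanh)
    ((ae_restrict_mem measurableSet_Ioi).mono hpos),
    integral_Ioi_of_hasDerivAt_of_nonneg' (fun t _ => htanh t) hpos tendsto_tanh]
  simp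

/-! ### Initial data and the excluded end point -/

section InitialData

variable {x₀ α₀ β₀ : ℝ} {c : ℝ → ℂ}

theorem mk_real_eq {ε s : ℝ} (hs : s = 0) : (⟨ε, s⟩ : ℂ) = (ε : ℂ) := by
  subst hs; rfl

/-- The image of a horizontal vector `ε` at `(x₀, α₀)` under the differential of `z ↦ -1 / (z -
x)`. -/
theorem inversion_velocity_re_im (ε x : ℝ) (hα : 0 < α₀) :
    ((ε : ℂ) / ((⟨x₀, α₀⟩ : ℂ) - x) ^ 2).re
        = ε * ((x₀ - x) ^ 2 - α₀ ^ 2) / (α₀ ^ 2 + (x₀ - x) ^ 2) ^ 2 ∧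
      ((ε : ℂ) / ((⟨x₀, α₀⟩ : ℂ) - x) ^ 2).im
        = -(2 * ε * (x₀ - x) * α₀) / (α₀ ^ 2 + (x₀ - x) ^ 2) ^ 2 := by
  have hD : 0 < α₀ ^ 2 + (x₀ - x) ^ 2 := by positivity
  have hw : ((⟨x₀, α₀⟩ : ℂ) - x) ≠ 0 := sub_ofReal_ne_zero hα x
  have e : (ε : ℂ) / ((⟨x₀, α₀⟩ : ℂ) - x) ^ 2
      = ⟨ε * ((x₀ - x) ^ 2 - α₀ ^ 2) / (α₀ ^ 2 + (x₀ - x) ^ 2) ^ 2,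
        -(2 * ε * (x₀ - x) * α₀) / (α₀ ^ 2 + (x₀ - x) ^ 2) ^ 2⟩ := by
    rw [div_eq_iff (pow_ne_zero 2 hw)]
    apply Complex.ext
    · simp [sq, Complex.mul_re, Complex.mul_im]
      field_simp
      ring
    · simp [sq, Complex.mul_re, Complex.mul_im]
      field_simp
      ring
  rw [e]
  exact ⟨rfl, rfl⟩

theorem sinDir_inversion_velocity {ε : ℝ} (hε : ε ^ 2 = 1) (x : ℝ) (hα : 0 < α₀) :
    sinDir ((ε : ℂ) / ((⟨x₀, α₀⟩ : ℂ) - x) ^ 2)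
      = -(2 * ε * (x₀ - x) * α₀) / (α₀ ^ 2 + (x₀ - x) ^ 2) := by
  have hD : 0 < α₀ ^ 2 + (x₀ - x) ^ 2 := by positivity
  have hn : ‖(ε : ℂ) / ((⟨x₀, α₀⟩ : ℂ) - x) ^ 2‖ = 1 / (α₀ ^ 2 + (x₀ - x) ^ 2) := by
    rw [norm_div, norm_pow, sq_norm_eq]
    have : ‖(ε : ℂ)‖ = 1 := by
      rw [Complex.norm_real, Real.norm_eq_abs]
      exact (pow_eq_one_iff_of_nonneg (abs_nonneg ε) two_ne_zero).mp (by rw [sq_abs, hε])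
    rw [this]
    simp
    ring
  rw [sinDir, hn, (inversion_velocity_re_im ε x hα).2]
  field_simp

theorem IsSingularArc.start_velocity {x : OnePoint ℝ} (h : IsSingularArc x₀ α₀ β₀ x c)
    (hβ : Real.sin β₀ = 0) :
    0 < ‖derivWithin c (Ico 0 1) 0‖ ∧
      derivWithin c (Ico 0 1) 0 = (‖derivWithin c (Ico 0 1) 0‖ : ℂ) * (Real.cos β₀ : ℂ) :=
  ⟨norm_pos_iff.mpr (h.regular 0 ⟨le_rfl, zero_lt_one⟩), by
    conv_lhs => rw [h.direction, mk_real_eq hβ]⟩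

theorem IsSingularArc.sinDir_inversion_start {x : OnePoint ℝ} (h : IsSingularArc x₀ α₀ β₀ x c)
    (hα : 0 < α₀) (hβ : Real.sin β₀ = 0) (y : ℝ) :
    sinDir (derivWithin c (Ico 0 1) 0 / (c 0 - y) ^ 2)
      = -(2 * Real.cos β₀ * (x₀ - y) * α₀) / (α₀ ^ 2 + (x₀ - y) ^ 2) := by
  obtain ⟨hk, hv⟩ := h.start_velocity hβ
  rw [hv, h.start, mul_div_assoc, sinDir_mul hk,
    sinDir_inversion_velocity (cos_sq_of_sin_eq_zero hβ) y hα]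

theorem IsSingularArc.sinDir_start {x : OnePoint ℝ} (h : IsSingularArc x₀ α₀ β₀ x c)
    (hβ : Real.sin β₀ = 0) : sinDir (derivWithin c (Ico 0 1) 0) = 0 := by
  obtain ⟨hk, hv⟩ := h.start_velocity hβ
  rw [hv, sinDir_mul hk]
  simp [sinDir]

theorem IsSingularArc.willmorePrimitive_real {x : ℝ}
    (h : IsSingularArc x₀ α₀ β₀ (x : OnePoint ℝ) c) (hα : 0 < α₀) (hβ : Real.sin β₀ = 0) :
    ∃ c1 c2 F, WillmorePrimitive c c1 c2 F
      (-(2 * Real.cos β₀ * (x₀ - x) * α₀) / (α₀ ^ 2 + (x₀ - x) ^ 2)) 2 := by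
  have := h.regularArc.willmorePrimitive x h.minimalEnd_real
  rw [h.sinDir_inversion_start hα hβ x, h.sinDir_start hβ, sub_zero] at this
  exact ⟨_, _, _, this⟩

theorem IsSingularArc.willmorePrimitive_infty (h : IsSingularArc x₀ α₀ β₀ OnePoint.infty c) :
    ∃ c1 c2 F, WillmorePrimitive c c1 c2 F 0 0 := by
  obtain ⟨lam, m, hl, hc⟩ := h.normalForm_infty
  refine ⟨_, _, fun _ => 0, h.regularArc, fun s hs => ?_, tendsto_const_nhds, tendsto_const_nhds⟩
  rw [h.regularArc.catenary_revIntegrand hl hc (Ioo_subset_Ico_self hs)]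
  exact hasDerivAt_const _ _

/-- At the excluded point the inverted arc would have to start vertically downwards, but neither
catenaries nor vertical lines that run off to infinity do so. -/
theorem IsSingularArc.ne_of_real {x : ℝ} (h : IsSingularArc x₀ α₀ β₀ (x : OnePoint ℝ) c)
    (hα : 0 < α₀) (hβ : Real.sin β₀ = 0) : x ≠ x₀ - Real.cos β₀ * α₀ := by
  rintro rfl
  have h1 := h.minimalEnd_real.start
  simp only [h.sinDir_inversion_start hα hβ] at h1
  have hcos := cos_sq_of_sin_eq_zero hβ
  have e : -(2 * Real.cos β₀ * (x₀ - (x₀ - Real.cos β₀ * α₀)) * α₀) /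
      (α₀ ^ 2 + (x₀ - (x₀ - Real.cos β₀ * α₀)) ^ 2) = -1 := by
    have : (x₀ - (x₀ - Real.cos β₀ * α₀)) = Real.cos β₀ * α₀ := by ring
    rw [this, div_eq_iff (by positivity)]
    linear_combination - α₀ ^ 2 * hcos
  rw [e] at h1
  exact lt_irrefl _ h1

/-! ### Existence of the singular arcs -/

/-- A path over `[0, ∞)` with the required shape becomes a singular arc after the reparametrisation
`s ↦ s / (1 - s)` of `[0, 1)`. -/
theorem isSingularArc_of_path {x : OnePoint ℝ} {Γ Γ' : ℝ → ℂ} (hΓ : ContDiff ℝ ∞ Γ)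
    (hd : ∀ τ, HasDerivAt Γ (Γ' τ) τ) (h0 : ∀ τ, Γ' τ ≠ 0) (hstart : Γ 0 = ⟨x₀, α₀⟩) {k : ℝ}
    (hk : 0 < k) (hdir : Γ' 0 = k * ⟨Real.cos β₀, Real.sin β₀⟩)
    (hreal : ∀ a : ℝ, x = (a : OnePoint ℝ) → Tendsto Γ atTop (𝓝 (a : ℂ)))
    (hinfty : x = OnePoint.infty → Tendsto (fun τ => ‖Γ τ‖) atTop atTop)
    (hshape : (∃ a b c' d : ℝ, 0 < a * d - b * c' ∧ ∀ τ, Γ τ ∈ moebiusCatenary a b c' d)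
      ∨ (∃ m r : ℝ, 0 < r ∧ ∀ τ, Γ τ ∈ halfCircle m r)) :
    IsSingularArc x₀ α₀ β₀ x fun s => Γ (s / (1 - s)) := by
  have hlim : Tendsto (fun s : ℝ => s / (1 - s)) (𝓝[<] 1) atTop := by
    have h1 : Tendsto (fun s : ℝ => 1 - s) (𝓝[<] 1) (𝓝[>] 0) := by
      refine tendsto_nhdsWithin_iff.mpr ⟨?_, ?_⟩
      · have : Tendsto (fun s : ℝ => 1 - s) (𝓝 1) (𝓝 (1 - 1)) := tendsto_id.const_sub 1
        rw [sub_self] at this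
        exact this.mono_left nhdsWithin_le_nhds
      · filter_upwards [self_mem_nhdsWithin] with s hs
        simpa using hs
    have h2 : Tendsto (fun s : ℝ => s) (𝓝[<] 1) (𝓝 1) := tendsto_id.mono_left nhdsWithin_le_nhds
    exact h2.pos_mul_atTop one_pos h1.inv_tendsto_nhdsGT_zero
  have hder : ∀ s ∈ Ico (0 : ℝ) 1, HasDerivAt (fun s => Γ (s / (1 - s)))
      (((1 / (1 - s) ^ 2 : ℝ) : ℂ) * Γ' (s / (1 - s))) s := by
    intro s hs
    have hs1 : 1 - s ≠ 0 := by linarith [hs.2]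
    have h1 : HasDerivAt (fun s : ℝ => s / (1 - s)) (1 / (1 - s) ^ 2) s := by
      refine ((hasDerivAt_id s).div ((hasDerivAt_id s).const_sub 1) hs1).congr_deriv ?_
      simp
    have h2 := (hd (s / (1 - s))).scomp s h1
    simpa [Function.comp_def] using h2
  have hdw : ∀ s ∈ Ico (0 : ℝ) 1, derivWithin (fun s => Γ (s / (1 - s))) (Ico 0 1) s
      = ((1 / (1 - s) ^ 2 : ℝ) : ℂ) * Γ' (s / (1 - s)) := fun s hs =>
    (hder s hs).hasDerivWithinAt.derivWithin (uniqueDiffOn_Ico 0 1 s hs)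
  have hz : (0 : ℝ) ∈ Ico (0 : ℝ) 1 := ⟨le_rfl, zero_lt_one⟩
  have hunit : ‖(⟨Real.cos β₀, Real.sin β₀⟩ : ℂ)‖ = 1 := by
    rw [← sq_eq_sq₀ (norm_nonneg _) zero_le_one, sq_norm_eq]
    simp
  refine ⟨?_, ?_, by simpa using hstart, ?_, fun a ha => (hreal a ha).comp hlim,
    fun h => (hinfty h).comp hlim, ?_⟩
  · refine hΓ.comp_contDiffOn (contDiffOn_id.div (contDiffOn_const.sub contDiffOn_id) ?_)
    intro s hs
    exact (sub_pos.mpr hs.2).ne'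
  · intro s hs
    rw [hdw s hs]
    have hs1 : 1 - s ≠ 0 := by linarith [hs.2]
    refine mul_ne_zero ?_ (h0 _)
    exact_mod_cast one_div_ne_zero (pow_ne_zero 2 hs1)
  · rw [hdw 0 hz]
    simp [hdir, hunit, abs_of_pos hk]
  · rcases hshape with ⟨a, b, c', d, h1, h2⟩ | ⟨m, r, h1, h2⟩
    · exact .inl ⟨a, b, c', d, h1, fun s _ => h2 _⟩
    · exact .inr ⟨m, r, h1, fun s _ => h2 _⟩

theorem contDiff_mk {f g : ℝ → ℝ} (hf : ContDiff ℝ ∞ f) (hg : ContDiff ℝ ∞ g) :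
    ContDiff ℝ ∞ fun t => (⟨f t, g t⟩ : ℂ) := by
  simp only [Complex.mk_eq_add_mul_I]
  exact (Complex.ofRealCLM.contDiff.comp hf).add
    ((Complex.ofRealCLM.contDiff.comp hg).mul contDiff_const)

/-- Through every `p` in every direction `v` other than vertically downwards there is a catenary,
or a vertical line if `v` is vertical, that runs off to infinity. -/
theorem exists_minimal_path {p v : ℂ} (hp : 0 < p.im) (hv : v.re ≠ 0 ∨ 0 < v.im) :
    ∃ G G' : ℝ → ℂ, ContDiff ℝ ∞ G ∧ (∀ τ, HasDerivAt G (G' τ) τ) ∧ (∀ τ, G' τ ≠ 0) ∧ G 0 = p ∧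
      (∃ k : ℝ, 0 < k ∧ G' 0 = k * v) ∧ Tendsto (fun τ => (G τ).im) atTop atTop ∧
      (∀ τ, 0 < (G τ).im) ∧
      ((∃ lam m : ℝ, 0 < lam ∧ ∀ τ, ∃ t : ℝ, G τ = lam * ⟨t, Real.cosh t⟩ + m) ∨
        (v.re = 0 ∧ ∀ τ, (G τ).re = p.re)) := by
  by_cases hre : v.re = 0
  · have hvi : 0 < v.im := hv.resolve_left (not_not.mpr hre)
    refine ⟨fun τ => ⟨p.re, p.im * Real.exp τ⟩, fun τ => ⟨0, p.im * Real.exp τ⟩,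
      contDiff_mk contDiff_const (contDiff_const.mul Real.contDiff_exp),
      fun τ => hasDerivAt_mk (hasDerivAt_const _ _) ((Real.hasDerivAt_exp τ).const_mul _), ?_, ?_,
      ⟨p.im / v.im, by positivity, ?_⟩, Real.tendsto_exp_atTop.const_mul_atTop hp,
      fun τ => by simp only; positivity, .inr ⟨hre, fun τ => rfl⟩⟩
    · intro τ h
      have := congrArg Complex.im h
      simp at this
      exact hp.ne' this
    · simp
    · apply Complex.ext
      · rw [Complex.re_ofReal_mul, hre]; simp
      · rw [Complex.im_ofReal_mul]; simp [hvi.ne']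
  · obtain ⟨σ, hσ, hσv⟩ : ∃ σ : ℝ, (σ = 1 ∨ σ = -1) ∧ σ * |v.re| = v.re := by
      rcases lt_or_gt_of_ne hre with h | h
      · exact ⟨-1, .inr rfl, by rw [abs_of_neg h]; ring⟩
      · exact ⟨1, .inl rfl, by rw [abs_of_pos h]; ring⟩
    have habs : 0 < |v.re| := abs_pos.mpr hre
    set t₀ := Real.arsinh (v.im / |v.re|) with ht₀
    have hsinh : Real.sinh t₀ = v.im / |v.re| := Real.sinh_arsinh _
    have hc0 := Real.cosh_pos t₀
    set lam := p.im / Real.cosh t₀ with hlam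
    have hl : 0 < lam := by positivity
    have hσ2 : σ ≠ 0 := by rcases hσ with rfl | rfl <;> norm_num
    refine ⟨fun τ => ⟨p.re + lam * (σ * τ), lam * Real.cosh (t₀ + τ)⟩,
      fun τ => ⟨lam * (σ * 1), lam * (Real.sinh (t₀ + τ) * 1)⟩,
      contDiff_mk ?_ ?_,
      fun τ => hasDerivAt_mk ((((hasDerivAt_id τ).const_mul _).const_mul _).const_add _)
        (((hasDerivAt_id τ).const_add t₀).cosh.const_mul _), ?_, ?_,
      ⟨lam / |v.re|, by positivity, ?_⟩, ?_, ?_, .inl ⟨lam, p.re - lam * (σ * t₀), hl, ?_⟩⟩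
    · exact contDiff_const.add (contDiff_const.mul (contDiff_const.mul contDiff_id))
    · exact contDiff_const.mul (Real.contDiff_cosh.comp (contDiff_const.add contDiff_id))
    · intro τ h
      have := congrArg Complex.re h
      simp at this
      exact this.elim hl.ne' hσ2
    · apply Complex.ext
      · simp
      · simp only [add_zero, hlam]; field_simp
    · apply Complex.ext
      · rw [Complex.re_ofReal_mul]
        simp only
        have e : lam / |v.re| * v.re = lam * σ := by
          rw [div_mul_eq_mul_div, div_eq_iff habs.ne', mul_assoc, hσv]
        rw [mul_one, e]
      · rw [Complex.im_ofReal_mul]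
        simp only [add_zero, hsinh]
        field_simp
    · exact (tendsto_cosh_atTop.comp
        (tendsto_atTop_add_const_left _ t₀ tendsto_id)).const_mul_atTop hl
    · intro τ
      exact mul_pos hl (Real.cosh_pos _)
    · intro τ
      refine ⟨σ * (t₀ + τ), ?_⟩
      apply Complex.ext
      · simp; ring
      · rw [Complex.add_im, Complex.im_ofReal_mul, Complex.ofReal_im, add_zero]
        simp only
        rcases hσ with rfl | rfl
        · rw [one_mul]
        · rw [neg_one_mul, Real.cosh_neg]

theorem exists_isSingularArc_infty (hα : 0 < α₀) (hβ : Real.sin β₀ = 0) :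
    ∃ c, IsSingularArc x₀ α₀ β₀ OnePoint.infty c := by
  have hre : ((Real.cos β₀ : ℂ)).re ≠ 0 := by
    rw [Complex.ofReal_re]
    intro h
    simpa [h] using cos_sq_of_sin_eq_zero hβ
  obtain ⟨G, G', h1, h2, h3, h4, ⟨k, hk, h5⟩, h6, h7, h8⟩ :=
    exists_minimal_path (p := ⟨x₀, α₀⟩) (v := (Real.cos β₀ : ℂ)) hα (.inl hre)
  refine ⟨_, isSingularArc_of_path h1 h2 h3 h4 hk (by rw [h5, mk_real_eq hβ]) ?_ ?_ (.inl ?_)⟩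
  · intro a ha
    exact absurd ha (OnePoint.infty_ne_coe a)
  · intro _
    exact tendsto_atTop_mono (fun τ => (le_abs_self _).trans (Complex.abs_im_le_norm _)) h6
  · rcases h8 with ⟨lam, m, hl, h8⟩ | ⟨h8, -⟩
    · refine ⟨lam, m, 0, 1, by linarith, fun τ => ?_⟩
      obtain ⟨t, ht⟩ := h8 τ
      refine ⟨t, ?_⟩
      simp [ht]
    · exact absurd h8 hre

/-- The curve is the image under the inverse of `z ↦ -1 / (z - x)` of the catenary or vertical line
through the transformed initial data; the only exception is the point for which the transformed
direction is vertically downwards. -/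
theorem exists_isSingularArc_real (hα : 0 < α₀) (hβ : Real.sin β₀ = 0) {x : ℝ}
    (hx : x ≠ x₀ - Real.cos β₀ * α₀) : ∃ c, IsSingularArc x₀ α₀ β₀ (x : OnePoint ℝ) c := by
  have hcos := cos_sq_of_sin_eq_zero hβ
  set ε := Real.cos β₀
  have hε : ε ≠ 0 := fun h => by rw [h] at hcos; norm_num at hcos
  have hD : 0 < α₀ ^ 2 + (x₀ - x) ^ 2 := by positivity
  have hw : (⟨x₀, α₀⟩ : ℂ) - x ≠ 0 := sub_ofReal_ne_zero hα x
  obtain ⟨hvre, hvim⟩ := inversion_velocity_re_im (x₀ := x₀) ε x hα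
  have hre0 : ((ε : ℂ) / ((⟨x₀, α₀⟩ : ℂ) - x) ^ 2).re = 0 → x₀ - x = -(ε * α₀) := by
    intro h
    rw [hvre, div_eq_zero_iff] at h
    have h := h.resolve_right (by positivity)
    have h := (mul_eq_zero.mp h).resolve_left hε
    have h : (x₀ - x - ε * α₀) * (x₀ - x + ε * α₀) = 0 := by linear_combination h - α₀ ^ 2 * hcos
    rcases mul_eq_zero.mp h with h | h
    · exact absurd (by linarith) hx
    · linarith
  have hpre : (-1 / ((⟨x₀, α₀⟩ : ℂ) - x)).re = -(x₀ - x) / (α₀ ^ 2 + (x₀ - x) ^ 2) := by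
    rw [neg_div, one_div, Complex.neg_re, Complex.inv_re, Complex.normSq_apply]
    simp
    ring
  obtain ⟨G, G', h1, h2, h3, h4, ⟨k, hk, h5⟩, h6, h7, h8⟩ :=
    exists_minimal_path (p := -1 / ((⟨x₀, α₀⟩ : ℂ) - x))
      (v := (ε : ℂ) / ((⟨x₀, α₀⟩ : ℂ) - x) ^ 2) (by
        rw [im_neg_inv]
        have := norm_pos_iff.mpr hw
        simp
        positivity) (by
        by_cases h : ((ε : ℂ) / ((⟨x₀, α₀⟩ : ℂ) - x) ^ 2).re = 0
        · right
          have e : -(2 * ε * (x₀ - x) * α₀) = 2 * α₀ ^ 2 := by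
            rw [hre0 h]; linear_combination 2 * α₀ ^ 2 * hcos
          rw [hvim, e]
          positivity
        · exact .inl h)
  have hG : ∀ τ, G τ ≠ 0 := fun τ h => by
    have := h7 τ
    rw [h] at this
    simp at this
  refine ⟨_, isSingularArc_of_path (Γ := fun τ => x - 1 / G τ) (Γ' := fun τ => G' τ / G τ ^ 2) ?_ ?_
    ?_ ?_ hk ?_ ?_ ?_ ?_⟩
  · simp only [one_div]
    exact contDiff_const.sub (h1.inv hG)
  · intro τ
    refine (((hasDerivAt_const τ (1 : ℂ)).div (h2 τ) (hG τ)).const_sub (x : ℂ)).congr_deriv ?_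
    simp [neg_div]
  · exact fun τ => div_ne_zero (h3 τ) (pow_ne_zero 2 (hG τ))
  · simp only [h4]
    field_simp
    ring
  · rw [h4, h5, mk_real_eq hβ]
    field_simp
    rfl
  · intro a ha
    rw [← OnePoint.coe_injective ha]
    have : Tendsto (fun τ => (1 : ℂ) / G τ) atTop (𝓝 0) := by
      rw [tendsto_zero_iff_norm_tendsto_zero]
      simp only [one_div, norm_inv]
      exact (tendsto_atTop_mono (fun τ => (le_abs_self _).trans (Complex.abs_im_le_norm _))
        h6).inv_tendsto_atTop
    simpa using this.const_sub (x : ℂ)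
  · intro h
    exact absurd h (OnePoint.coe_ne_infty x)
  · rcases h8 with ⟨lam, m, hl, h8⟩ | ⟨hv0, h8⟩
    · left
      refine ⟨x * lam, x * m - 1, lam, m, by linarith, fun τ => ?_⟩
      obtain ⟨t, ht⟩ := h8 τ
      refine ⟨t, ?_⟩
      have hGt := hG τ
      simp only
      rw [ht] at hGt ⊢
      push_cast
      field_simp
      ring
    · right
      have hm : x₀ - x ≠ 0 := by
        rw [hre0 hv0]
        exact neg_ne_zero.mpr (mul_ne_zero hε hα.ne')
      set m := -(x₀ - x) / (α₀ ^ 2 + (x₀ - x) ^ 2) with hmdef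
      have hm0 : m ≠ 0 := div_ne_zero (neg_ne_zero.mpr hm) hD.ne'
      refine ⟨x - 1 / (2 * m), |1 / (2 * m)|, abs_pos.mpr (by positivity), fun τ => ?_⟩
      have hGre : (G τ).re = m := by rw [h8, hpre]
      have hGim := h7 τ
      have e1 : ((x : ℂ) - 1 / G τ).re = x - m / (m ^ 2 + (G τ).im ^ 2) := by
        rw [Complex.sub_re, one_div, Complex.inv_re, Complex.normSq_apply, hGre]
        simp [sq]
      have e2 : ((x : ℂ) - 1 / G τ).im = (G τ).im / (m ^ 2 + (G τ).im ^ 2) := by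
        rw [Complex.sub_im, one_div, Complex.inv_im, Complex.normSq_apply, hGre]
        simp [sq, neg_div]
      refine ⟨by rw [e2]; positivity, ?_⟩
      rw [e1, e2, sq_abs]
      field_simp
      ring

end InitialData

/-! ### Surfaces of finite area -/

/-- The set obtained by rotating a subset of the half plane around the first coordinate axis. -/
def rotSet (P : Set ℂ) : Set E3 :=
  {p | ∃ z ∈ P, ∃ φ : ℝ, p = !₂[z.re, z.im * Real.cos φ, z.im * Real.sin φ]}

theorem revSurface_eq_rotSet (γ : ℝ → ℂ) (I : Set ℝ) : revSurface γ I = rotSet (γ '' I) := by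
  ext p
  constructor
  · rintro ⟨s, hs, φ, rfl⟩
    exact ⟨γ s, mem_image_of_mem _ hs, φ, rfl⟩
  · rintro ⟨_, ⟨s, hs, rfl⟩, φ, rfl⟩
    exact ⟨s, hs, φ, rfl⟩

theorem rotSet_mono {P Q : Set ℂ} (h : P ⊆ Q) : rotSet P ⊆ rotSet Q := by
  rintro p ⟨z, hz, φ, rfl⟩
  exact ⟨z, h hz, φ, rfl⟩

theorem rotSet_union (P Q : Set ℂ) : rotSet (P ∪ Q) = rotSet P ∪ rotSet Q := by
  ext p
  constructor
  · rintro ⟨z, hz | hz, φ, rfl⟩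
    · exact .inl ⟨z, hz, φ, rfl⟩
    · exact .inr ⟨z, hz, φ, rfl⟩
  · rintro (⟨z, hz, φ, rfl⟩ | ⟨z, hz, φ, rfl⟩)
    · exact ⟨z, .inl hz, φ, rfl⟩
    · exact ⟨z, .inr hz, φ, rfl⟩

theorem rotSet_iUnion {ι : Type*} (P : ι → Set ℂ) : rotSet (⋃ i, P i) = ⋃ i, rotSet (P i) := by
  ext p
  simp only [rotSet, mem_iUnion, mem_ofPred_eq]
  constructor
  · rintro ⟨z, ⟨i, hz⟩, φ, rfl⟩
    exact ⟨i, z, hz, φ, rfl⟩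
  · rintro ⟨i, z, hz, φ, rfl⟩
    exact ⟨z, ⟨i, hz⟩, φ, rfl⟩

theorem sub_vec3 (a b c a' b' c' : ℝ) :
    (!₂[a, b, c] : E3) - !₂[a', b', c'] = !₂[a - a', b - b', c - c'] := by
  ext i; fin_cases i <;> simp

/-- The source carries the supremum metric. -/
theorem lipschitzOnWith_revParam {γ : ℝ → ℂ} {J : Set ℝ} {K B : NNReal}
    (hγ : LipschitzOnWith K γ J) (hB : ∀ s ∈ J, |(γ s).im| ≤ B) :
    LipschitzOnWith (K + B) (fun p : ℝ × ℝ => revParam γ p.1 p.2) (J ×ˢ univ) := by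
  refine LipschitzOnWith.of_dist_le_mul ?_
  rintro ⟨s, φ⟩ ⟨hs, -⟩ ⟨t, ψ⟩ ⟨ht, -⟩
  simp only at hs ht ⊢
  have h1 : dist (revParam γ s φ) (revParam γ t φ) ≤ K * dist s t := by
    refine le_trans (le_of_eq ?_) (hγ.dist_le_mul s hs t ht)
    rw [dist_eq_norm, dist_eq_norm, revParam, revParam, sub_vec3, norm_vec3,
      Real.sqrt_eq_iff_mul_self_eq (by positivity) (norm_nonneg _), ← sq, sq_norm_eq,
      Complex.sub_re, Complex.sub_im]
    linear_combination (((γ s).im - (γ t).im) ^ 2) * Real.sin_sq_add_cos_sq φ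
  have h2 : dist (revParam γ t φ) (revParam γ t ψ) ≤ B * dist φ ψ := by
    rw [dist_eq_norm, Real.dist_eq, revParam, revParam, sub_vec3, norm_vec3]
    refine (Real.sqrt_le_iff.mpr ⟨by positivity, ?_⟩ : _ ≤ |(γ t).im| * |φ - ψ|).trans
      (mul_le_mul_of_nonneg_right (hB t ht) (abs_nonneg _))
    have h3 := Real.one_sub_sq_div_two_le_cos (x := φ - ψ)
    rw [Real.cos_sub] at h3
    rw [mul_pow, sq_abs, sq_abs]
    have e : ((γ t).re - (γ t).re) ^ 2 + ((γ t).im * Real.cos φ - (γ t).im * Real.cos ψ) ^ 2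
        + ((γ t).im * Real.sin φ - (γ t).im * Real.sin ψ) ^ 2
        = (γ t).im ^ 2 * (2 - 2 * (Real.cos φ * Real.cos ψ + Real.sin φ * Real.sin ψ)) := by
      linear_combination (γ t).im ^ 2 * (Real.sin_sq_add_cos_sq φ + Real.sin_sq_add_cos_sq ψ)
    rw [e]
    exact mul_le_mul_of_nonneg_left (by linarith) (sq_nonneg _)
  calc dist (revParam γ s φ) (revParam γ t ψ) ≤ K * dist s t + B * dist φ ψ :=
        (dist_triangle _ _ _).trans (add_le_add h1 h2)
    _ ≤ K * dist (s, φ) (t, ψ) + B * dist (s, φ) (t, ψ) := by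
        rw [Prod.dist_eq]
        gcongr
        · exact le_max_left _ _
        · exact le_max_right _ _
    _ = _ := by push_cast; ring

theorem revSurface_eq_image (γ : ℝ → ℂ) (J : Set ℝ) :
    revSurface γ J = (fun p : ℝ × ℝ => revParam γ p.1 p.2) '' (J ×ˢ Ico 0 (2 * π)) := by
  ext p
  constructor
  · rintro ⟨s, hs, φ, rfl⟩
    refine ⟨(s, toIcoMod Real.two_pi_pos 0 φ), ⟨hs, ?_⟩, ?_⟩
    · simpa using toIcoMod_mem_Ico Real.two_pi_pos 0 φ
    · have e : toIcoMod Real.two_pi_pos 0 φ = φ - toIcoDiv Real.two_pi_pos 0 φ * (2 * π) := by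
        rw [toIcoMod, zsmul_eq_mul]
      simp only [revParam, e, Real.cos_sub_int_mul_two_pi, Real.sin_sub_int_mul_two_pi]
  · rintro ⟨⟨s, φ⟩, ⟨hs, -⟩, rfl⟩
    exact ⟨s, hs, φ, rfl⟩

theorem hausdorffMeasure_revSurface_le {γ : ℝ → ℂ} {J : Set ℝ} {K B : NNReal}
    (hγ : LipschitzOnWith K γ J) (hB : ∀ s ∈ J, |(γ s).im| ≤ B) :
    μH[2] (revSurface γ J)
      ≤ ((K + B : NNReal) : ℝ≥0∞) ^ 2 * (volume J * ENNReal.ofReal (2 * π)) := by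
  rw [revSurface_eq_image]
  have h := ((lipschitzOnWith_revParam hγ hB).mono
    (prod_mono_right (subset_univ (Ico 0 (2 * π))))).hausdorffMeasure_image_le (d := 2) zero_le_two
  rw [hausdorffMeasure_prod_real, Measure.volume_eq_prod, Measure.prod_prod, Real.volume_Ico,
    sub_zero] at h
  simpa using h

theorem euclideanHausdorffMeasure_lt_top {S : Set E3} (h : μH[2] S < ⊤) :
    (Measure.euclideanHausdorffMeasure 2 : Measure E3) S < ⊤ := by
  rw [Measure.euclideanHausdorffMeasure_def, Measure.smul_apply]
  exact ENNReal.mul_lt_top ENNReal.coe_lt_top (by simpa using h)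

theorem hausdorffMeasure_rotSet_halfCircle_lt_top (m : ℝ) {r : ℝ} (hr : 0 < r) :
    μH[2] (rotSet (halfCircle m r)) < ⊤ := by
  set γ : ℝ → ℂ := fun t => ⟨m + r * Real.cos t, r * Real.sin t⟩
  have hsub : halfCircle m r ⊆ γ '' Icc 0 (2 * π) := by
    rintro z ⟨-, hz⟩
    have hn : ‖z - m‖ = r := by
      rw [← sq_eq_sq₀ (norm_nonneg _) hr.le, sq_norm_eq]
      simpa using hz
    have h0 := toIcoMod_mem_Ico Real.two_pi_pos 0 (Complex.arg (z - m))
    refine ⟨_, ⟨h0.1, by linarith [h0.2]⟩, ?_⟩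
    have e : toIcoMod Real.two_pi_pos 0 (Complex.arg (z - m))
        = Complex.arg (z - m) - toIcoDiv Real.two_pi_pos 0 (Complex.arg (z - m)) * (2 * π) := by
      rw [toIcoMod, zsmul_eq_mul]
    apply Complex.ext
    · simp only [γ, e, Real.cos_sub_int_mul_two_pi]
      rw [← hn, Complex.norm_mul_cos_arg]; simp
    · simp only [γ, e, Real.sin_sub_int_mul_two_pi]
      rw [← hn, Complex.norm_mul_sin_arg]; simp
  have hd : ∀ t, HasDerivAt γ ⟨r * -Real.sin t, r * Real.cos t⟩ t := fun t =>
    hasDerivAt_mk (((Real.hasDerivAt_cos t).const_mul r).const_add m)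
      ((Real.hasDerivAt_sin t).const_mul r)
  have hL : LipschitzOnWith r.toNNReal γ (Icc 0 (2 * π)) := by
    refine Convex.lipschitzOnWith_of_nnnorm_hasDerivWithin_le (convex_Icc _ _)
      (fun t _ => (hd t).hasDerivWithinAt) fun t _ => ?_
    rw [← NNReal.coe_le_coe, coe_nnnorm, Real.coe_toNNReal _ hr.le]
    rw [← sq_le_sq₀ (norm_nonneg _) hr.le, sq_norm_eq]
    simp only
    nlinarith [Real.sin_sq_add_cos_sq t]
  have hB : ∀ t ∈ Icc 0 (2 * π), |(γ t).im| ≤ r.toNNReal := by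
    intro t _
    rw [Real.coe_toNNReal _ hr.le]
    simp only [γ, abs_mul, abs_of_pos hr]
    exact mul_le_of_le_one_right hr.le (Real.abs_sin_le_one t)
  refine (measure_mono (rotSet_mono hsub)).trans_lt ?_
  rw [← revSurface_eq_rotSet]
  refine (hausdorffMeasure_revSurface_le hL hB).trans_lt ?_
  rw [Real.volume_Icc]
  finiteness

/-- Inverting a catenary at a boundary point gives a profile of finite area: over `[n, n + 1]` the
curve has length and distance to the axis at most a multiple of `exp (-n)`. The sign `σ` covers
both halves of the catenary. -/
theorem hausdorffMeasure_half_lt_top (x m σ : ℝ) {lam : ℝ} (hl : 0 < lam) (hσ : σ ^ 2 = 1) :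
    μH[2] (revSurface (fun t => x - (⟨m + lam * (σ * t), lam * Real.cosh t⟩ : ℂ)⁻¹)
      (Ici 0)) < ⊤ := by
  set G : ℝ → ℂ := fun t => ⟨m + lam * (σ * t), lam * Real.cosh t⟩ with hGdef
  set γ : ℝ → ℂ := fun t => x - (G t)⁻¹ with hγdef
  have hGn : ∀ t, lam * Real.cosh t ≤ ‖G t‖ := fun t =>
    (le_abs_self _).trans (Complex.abs_im_le_norm (G t))
  have hcp : ∀ t, 0 < lam * Real.cosh t := fun t => mul_pos hl (Real.cosh_pos t)
  have hG0 : ∀ t, G t ≠ 0 := fun t => norm_pos_iff.mp ((hcp t).trans_le (hGn t))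
  have hGd : ∀ t, HasDerivAt G ⟨lam * (σ * 1), lam * Real.sinh t⟩ t := fun t =>
    hasDerivAt_mk ((((hasDerivAt_id t).const_mul σ).const_mul lam).const_add m)
      ((Real.hasDerivAt_cosh t).const_mul lam)
  have hG' : ∀ t, ‖(⟨lam * (σ * 1), lam * Real.sinh t⟩ : ℂ)‖ = lam * Real.cosh t := by
    intro t
    rw [← sq_eq_sq₀ (norm_nonneg _) (hcp t).le, sq_norm_eq]
    simp only
    have := Real.cosh_sq t
    linear_combination lam ^ 2 * hσ - lam ^ 2 * this
  have hd : ∀ t, HasDerivAt γ ((⟨lam * (σ * 1), lam * Real.sinh t⟩ : ℂ) / G t ^ 2) t := by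
    intro t
    refine ((hGd t).inv (hG0 t)).const_sub (x : ℂ) |>.congr_deriv ?_
    rw [neg_div, neg_neg]
  have hexp : ∀ (n : ℕ) (t : ℝ), (n : ℝ) ≤ t →
      1 / (lam * Real.cosh t) ≤ 2 / lam * Real.exp (-n) := by
    intro n t ht
    have h1 : Real.exp n / 2 ≤ Real.cosh t := by
      rw [Real.cosh_eq]
      have := Real.exp_le_exp.mpr ht
      linarith [Real.exp_pos (-t)]
    have h2 := Real.exp_pos (n : ℝ)
    calc 1 / (lam * Real.cosh t) ≤ 1 / (lam * (Real.exp n / 2)) := by gcongr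
      _ = _ := by rw [Real.exp_neg]; field_simp
  set C : ℕ → NNReal := fun n => (2 / lam * Real.exp (-n)).toNNReal with hC
  have hCr : ∀ n, (C n : ℝ) = 2 / lam * Real.exp (-n) := fun n =>
    Real.coe_toNNReal _ (by positivity)
  have hL : ∀ n : ℕ, LipschitzOnWith (C n) γ (Icc n (n + 1)) := by
    intro n
    refine Convex.lipschitzOnWith_of_nnnorm_hasDerivWithin_le (convex_Icc _ _)
      (fun t _ => (hd t).hasDerivWithinAt) fun t ht => ?_
    rw [← NNReal.coe_le_coe, coe_nnnorm, hCr]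
    refine le_trans ?_ (hexp n t ht.1)
    rw [norm_div, norm_pow, hG' t, div_le_div_iff₀ (pow_pos (norm_pos_iff.mpr (hG0 t)) 2) (hcp t)]
    nlinarith [hGn t, hcp t]
  have hB : ∀ n : ℕ, ∀ t ∈ Icc (n : ℝ) (n + 1), |(γ t).im| ≤ C n := by
    intro n t ht
    rw [hCr]
    refine le_trans ?_ (hexp n t ht.1)
    have e : |(γ t).im| ≤ ‖(G t)⁻¹‖ := by
      have : (γ t).im = -((G t)⁻¹).im := by simp [hγdef]
      rw [this, abs_neg]
      exact Complex.abs_im_le_norm _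
    refine e.trans ?_
    rw [norm_inv, ← one_div]
    exact one_div_le_one_div_of_le (hcp t) (hGn t)
  have hcover : Ici (0 : ℝ) ⊆ ⋃ n : ℕ, Icc (n : ℝ) (n + 1) := by
    intro t ht
    exact mem_iUnion.mpr ⟨⌊t⌋₊, Nat.floor_le ht, (Nat.lt_floor_add_one t).le⟩
  rw [revSurface_eq_rotSet]
  refine (measure_mono (rotSet_mono (image_mono hcover))).trans_lt ?_
  rw [image_iUnion, rotSet_iUnion]
  refine (measure_iUnion_le _).trans_lt ?_
  have hsum : Summable fun n : ℕ => (C n + C n) ^ 2 * (2 * π).toNNReal := by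
    rw [← NNReal.summable_coe]
    have : ∀ n : ℕ, (((C n + C n) ^ 2 * (2 * π).toNNReal : NNReal) : ℝ)
        = (4 / lam) ^ 2 * (2 * π) * (Real.exp (-2)) ^ n := by
      intro n
      push_cast
      rw [hCr, Real.coe_toNNReal _ Real.two_pi_pos.le, ← Real.exp_nat_mul]
      have : Real.exp (n * -2) = Real.exp (-n) ^ 2 := by
        rw [← Real.exp_nat_mul]; congr 1; push_cast; ring
      rw [this]; ring
    simp only [this]
    exact (summable_geometric_of_lt_one (Real.exp_pos _).le
      (by rw [Real.exp_lt_one_iff]; norm_num)).mul_left _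
  refine lt_of_le_of_lt (ENNReal.tsum_le_tsum fun n => ?_)
    (ENNReal.tsum_coe_ne_top_iff_summable.mpr hsum).lt_top
  rw [← revSurface_eq_rotSet]
  refine (hausdorffMeasure_revSurface_le (hL n) (hB n)).trans (le_of_eq ?_)
  rw [Real.volume_Icc, add_sub_cancel_left, ENNReal.ofReal_one, one_mul]
  push_cast
  rfl

/-- A singular arc with a finite end point generates a surface of finite area. -/
theorem IsSingularArc.hausdorffMeasure_lt_top {x₀ α₀ β₀ x : ℝ} {c : ℝ → ℂ}
    (h : IsSingularArc x₀ α₀ β₀ (x : OnePoint ℝ) c) : μH[2] (rotSet (c '' Ico 0 1)) < ⊤ := by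
  rcases h.normalForm_real with ⟨lam, m, hl, hc⟩ | ⟨-, m, r, hr, hc⟩
  · set Γ : ℝ → ℝ → ℂ := fun σ t => x - (⟨m + lam * (σ * t), lam * Real.cosh t⟩ : ℂ)⁻¹
    have hsub : c '' Ico 0 1 ⊆ Γ 1 '' Ici 0 ∪ Γ (-1) '' Ici 0 := by
      rintro _ ⟨s, hs, rfl⟩
      set u := ((-1 / (c s - x)).re - m) / lam with hu
      have hw := sub_ofReal_ne_zero (h.im_pos hs) x
      have hcs : c s = x - (⟨m + lam * u, lam * Real.cosh u⟩ : ℂ)⁻¹ := by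
        have e : (⟨m + lam * u, lam * Real.cosh u⟩ : ℂ) = -1 / (c s - x) := by
          apply Complex.ext
          · simp only [hu]; field_simp; ring
          · exact (hc s hs).symm
        rw [e]
        field_simp
        ring
      rcases le_total 0 u with h0 | h0
      · exact .inl ⟨u, h0, by rw [hcs]; simp [Γ]⟩
      · exact .inr ⟨-u, neg_nonneg.mpr h0, by rw [hcs]; simp [Γ]⟩
    refine (measure_mono (rotSet_mono hsub)).trans_lt ?_
    rw [rotSet_union, ← revSurface_eq_rotSet, ← revSurface_eq_rotSet]
    exact (measure_union_le _ _).trans_lt (ENNReal.add_lt_top.mpr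
      ⟨hausdorffMeasure_half_lt_top x m 1 hl (by norm_num),
        hausdorffMeasure_half_lt_top x m (-1) hl (by norm_num)⟩)
  · refine (measure_mono (rotSet_mono ?_)).trans_lt (hausdorffMeasure_rotSet_halfCircle_lt_top m hr)
    rintro _ ⟨s, hs, rfl⟩
    exact hc s hs

theorem tendsto_div_area {C : ℝ≥0∞} (hC : C ≠ ⊤) :
    Tendsto (fun R : ℝ => C / ENNReal.ofReal (π * R ^ 2)) atTop (𝓝 0) := by
  have h1 : Tendsto (fun R : ℝ => π * R ^ 2) atTop atTop :=
    (tendsto_pow_atTop two_ne_zero).const_mul_atTop Real.pi_pos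
  have := ENNReal.Tendsto.const_div (ENNReal.tendsto_ofReal_atTop.comp h1) (a := C) (.inr hC)
  simpa using this

theorem densityAtInfinity_eq_zero {S : Set E3} (h : μH[2] S < ⊤) : densityAtInfinity S = 0 := by
  have h' := euclideanHausdorffMeasure_lt_top h
  rw [densityAtInfinity]
  refine Tendsto.limsup_eq (tendsto_of_tendsto_of_tendsto_of_le_of_le tendsto_const_nhds
    (tendsto_div_area h'.ne) (fun _ => zero_le) fun R => ?_)
  refine ENNReal.div_le_div_right ?_ _
  rw [Measure.restrict_apply Metric.isClosed_closedBall.measurableSet]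
  exact measure_mono inter_subset_right

theorem densityAtInfinity_capCurve {x₀ α β : ℝ} (hα : 0 < α) (hβ : Real.sin β = 0) :
    densityAtInfinity (revSurface (capCurve x₀ α β) (Iic 0)) = 0 := by
  refine densityAtInfinity_eq_zero ?_
  rw [revSurface_eq_rotSet]
  refine (measure_mono (rotSet_mono ?_)).trans_lt (hausdorffMeasure_rotSet_halfCircle_lt_top x₀ hα)
  have hcos := cos_sq_of_sin_eq_zero hβ
  rintro _ ⟨t, -, rfl⟩
  rw [capCurve_of_sin_eq_zero hβ]
  have hp := Real.cosh_pos t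
  refine ⟨by simp only; positivity, ?_⟩
  simp only
  have := Real.cosh_sq t
  field_simp
  rw [add_sub_cancel_left]
  field_simp
  linear_combination Real.sinh t ^ 2 * hcos - this

/-! ### The area of half catenoids in large balls -/

/-- The half of the catenary with lowest point `(x₀, α)` that runs in direction `ε = ±1`. -/
def halfCatenary (x₀ α ε : ℝ) : Set ℂ :=
  (fun u : ℝ => (⟨x₀ + ε * α * u, α * Real.cosh u⟩ : ℂ)) '' Ici 0

/-- The horizontal initial direction puts the starting point at the lowest point of the catenary. -/
theorem IsSingularArc.image_eq_halfCatenary {x₀ α₀ β₀ : ℝ} {c : ℝ → ℂ}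
    (h : IsSingularArc x₀ α₀ β₀ OnePoint.infty c) (hβ : Real.sin β₀ = 0) :
    c '' Ico 0 1 = halfCatenary x₀ α₀ (Real.cos β₀) := by
  obtain ⟨lam, m, hl, hc⟩ := h.normalForm_infty
  have hreg := h.regularArc
  obtain ⟨σ, hσ, hpos, hmono, hlim⟩ := hreg.catenary_exists_sign hl hc (h.tendsto_infty rfl)
  have h0 : (0 : ℝ) ∈ Ico (0 : ℝ) 1 := ⟨le_rfl, zero_lt_one⟩
  obtain ⟨hk, hv⟩ := h.start_velocity hβ
  have him : (derivWithin c (Ico 0 1) 0).im = 0 := by rw [hv]; simp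
  have hre : (derivWithin c (Ico 0 1) 0).re = ‖derivWithin c (Ico 0 1) 0‖ * Real.cos β₀ := by
    conv_lhs => rw [hv]
    rw [Complex.re_ofReal_mul, Complex.ofReal_re]
  have hm : x₀ = m := by
    have h1 := hreg.catenary_im_deriv hl hc h0
    rw [him] at h1
    have h2 := (mul_eq_zero.mp h1.symm).resolve_right (hreg.catenary_re_ne_zero hl hc h0)
    rw [Real.sinh_eq_zero, div_eq_zero_iff] at h2
    have h3 := h2.resolve_right hl.ne'
    rw [h.start] at h3
    simp only at h3
    linarith
  subst hm
  have hlam : α₀ = lam := by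
    have := hc 0 h0
    rw [h.start] at this
    simpa using this
  subst hlam
  have hcos := cos_sq_of_sin_eq_zero hβ
  have hσε : σ = Real.cos β₀ := by
    have h1 := hpos 0 h0
    rw [hre] at h1
    have h2 : 0 < σ * Real.cos β₀ := by
      have : 0 < ‖derivWithin c (Ico 0 1) 0‖ * (σ * Real.cos β₀) := by linarith
      exact (mul_pos_iff_of_pos_left hk).mp this
    rcases mul_self_eq_one_iff.mp ((sq _).symm.trans hcos) with e | e <;>
      rcases hσ with rfl | rfl <;> rw [e] at h2 ⊢ <;> norm_num at h2
  subst hσε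
  set U : ℝ → ℝ := fun s => Real.cos β₀ * (((c s).re - x₀) / α₀) with hU
  have hU0 : U 0 = 0 := by simp [hU, h.start]
  have hcU : ∀ s ∈ Ico (0 : ℝ) 1,
      c s = ⟨x₀ + Real.cos β₀ * α₀ * U s, α₀ * Real.cosh (U s)⟩ := by
    intro s hs
    apply Complex.ext
    · simp only [hU]
      field_simp
      linear_combination (x₀ - (c s).re) * hcos
    · simp only [hU]
      rw [hc s hs]
      rcases hσ with e | e <;> rw [e]
      · rw [one_mul]
      · rw [neg_one_mul, Real.cosh_neg]
  have himg : U '' Ico 0 1 = Ici 0 := by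
    refine Subset.antisymm ?_ ?_
    · rintro _ ⟨s, hs, rfl⟩
      have := hmono h0 hs hs.1
      rw [mem_Ici, ← hU0]; exact this
    · have hcont : ContinuousOn U (Ico 0 1) := fun s hs =>
        ((((hasDerivWithinAt_re (hreg.hasDeriv s hs)).sub_const x₀).div_const α₀).const_mul
          _).continuousWithinAt
      intro B hB
      obtain ⟨s, h1, hs⟩ := ((hlim.eventually_ge_atTop B).and eventually_mem_Ico).exists
      exact isPreconnected_Ico.intermediate_value h0 hs hcont ⟨by rw [hU0]; exact hB, h1⟩
  rw [halfCatenary, ← himg, image_image]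
  exact image_congr hcU

/-- The projection of three-space along the axis of rotation. -/
def axisProj (p : E3) : EuclideanSpace ℝ (Fin 2) := !₂[p 1, p 2]

theorem norm_vec2 (a b : ℝ) : ‖(!₂[a, b] : EuclideanSpace ℝ (Fin 2))‖ = √(a ^ 2 + b ^ 2) := by
  simp [EuclideanSpace.norm_eq, Fin.sum_univ_two]

theorem sub_vec2 (a b a' b' : ℝ) :
    (!₂[a, b] : EuclideanSpace ℝ (Fin 2)) - !₂[a', b'] = !₂[a - a', b - b'] := by
  ext i; fin_cases i <;> simp

theorem eq_vec2 (y : EuclideanSpace ℝ (Fin 2)) : y = !₂[y 0, y 1] := by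
  ext i; fin_cases i <;> simp

theorem eq_vec3 (p : E3) : p = !₂[p 0, p 1, p 2] := by
  ext i; fin_cases i <;> simp

theorem lipschitzWith_axisProj : LipschitzWith 1 axisProj := by
  refine LipschitzWith.of_dist_le_mul fun p q => ?_
  rw [NNReal.coe_one, one_mul, dist_eq_norm, dist_eq_norm]
  conv_rhs => rw [eq_vec3 p, eq_vec3 q]
  rw [axisProj, axisProj, sub_vec2, sub_vec3, norm_vec2, norm_vec3]
  refine Real.sqrt_le_sqrt ?_
  nlinarith [sq_nonneg (p 0 - q 0)]

theorem LipschitzOnWith.euclideanHausdorffMeasure_image_le {X Y : Type*} [EMetricSpace X]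
    [EMetricSpace Y] [MeasurableSpace X] [BorelSpace X] [MeasurableSpace Y] [BorelSpace Y]
    {K : NNReal} {f : X → Y} {s : Set X} (h : LipschitzOnWith K f s) :
    Measure.euclideanHausdorffMeasure 2 (f '' s)
      ≤ (K : ℝ≥0∞) ^ 2 * Measure.euclideanHausdorffMeasure 2 s := by
  rw [Measure.euclideanHausdorffMeasure_def, Measure.euclideanHausdorffMeasure_def,
    Measure.smul_apply, Measure.smul_apply]
  have := h.hausdorffMeasure_image_le (d := (2 : ℕ)) (by positivity)
  rw [ENNReal.rpow_natCast] at this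
  rw [ENNReal.smul_def, ENNReal.smul_def, smul_eq_mul, smul_eq_mul, mul_left_comm]
  gcongr

/-- Lower bound for the area of the part of a half catenoid with `ε p₀ > M`, up to an additive
constant: its projection along the axis covers the disc of radius `R / (1 + δ)` but for a fixed
disc. -/
theorem catenoid_area_ge (x₀ ε M : ℝ) {α δ : ℝ} (hα : 0 < α) (hδ : 0 < δ) (hε : ε ^ 2 = 1) :
    ∃ C : ℝ≥0∞, C ≠ ⊤ ∧ ∀ R : ℝ, 0 ≤ R → ENNReal.ofReal ((1 / (1 + δ)) ^ 2 * (π * R ^ 2)) ≤ C +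
      (Measure.euclideanHausdorffMeasure 2 : Measure E3)
        (Metric.closedBall 0 R ∩ (rotSet (halfCatenary x₀ α ε) ∩ {p | M < ε * p 0})) := by
  -- Far out the axial coordinate is small compared with the distance to the axis.
  obtain ⟨u₀, hu₀⟩ : ∃ u₀ : ℝ, ∀ u ≥ u₀, 0 ≤ u ∧ M < ε * x₀ + α * u ∧
      |x₀ + ε * α * u| ≤ δ * (α * Real.cosh u) := by
    rw [← eventually_atTop]
    have l1 : Tendsto (fun u : ℝ => ε * x₀ + α * u) atTop atTop :=
      tendsto_atTop_add_const_left _ _ (tendsto_id.const_mul_atTop hα)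
    have l2 : Tendsto (fun u : ℝ => |x₀ * (Real.cosh u)⁻¹ + ε * α * (u / Real.cosh u)|) atTop
        (𝓝 |x₀ * 0 + ε * α * 0|) :=
      ((tendsto_inv_cosh.const_mul x₀).add (tendsto_id_div_cosh.const_mul (ε * α))).abs
    have l3 := l2.eventually_le_const (u := δ * α) (by simp; positivity)
    filter_upwards [eventually_ge_atTop 0, l1.eventually_gt_atTop M, l3] with u h1 h2 h3
    refine ⟨h1, h2, ?_⟩
    have hp := Real.cosh_pos u
    have e : x₀ + ε * α * u = (x₀ * (Real.cosh u)⁻¹ + ε * α * (u / Real.cosh u)) * Real.cosh u := by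
      field_simp
    rw [e, abs_mul, abs_of_pos hp, ← mul_assoc]
    gcongr
  set r₀ := α * Real.cosh u₀
  have hu0 : 0 ≤ u₀ := (hu₀ u₀ le_rfl).1
  refine ⟨volume (Metric.closedBall (0 : EuclideanSpace ℝ (Fin 2)) r₀),
    measure_closedBall_lt_top.ne, fun R hR => ?_⟩
  have hsub : Metric.closedBall (0 : EuclideanSpace ℝ (Fin 2)) (R / (1 + δ)) ⊆
      Metric.closedBall 0 r₀ ∪ axisProj '' (Metric.closedBall 0 R ∩
        (rotSet (halfCatenary x₀ α ε) ∩ {p | M < ε * p 0})) := by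
    intro y hy
    rw [mem_closedBall_zero_iff] at hy
    by_cases hr : ‖y‖ ≤ r₀
    · exact .inl (mem_closedBall_zero_iff.mpr hr)
    right
    push Not at hr
    have h1 : Real.cosh u₀ ≤ ‖y‖ / α := by
      rw [le_div_iff₀ hα, mul_comm]; exact hr.le
    obtain ⟨u, hu, hcu⟩ : ∃ u, u₀ ≤ u ∧ α * Real.cosh u = ‖y‖ := by
      refine ⟨Real.arcosh (‖y‖ / α), ?_, ?_⟩
      · have h2 := (Real.arcosh_le_arcosh (Real.cosh_pos u₀)
          ((Real.cosh_pos u₀).trans_le h1)).mpr h1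
        rwa [Real.arcosh_cosh hu0] at h2
      · rw [Real.cosh_arcosh ((Real.one_le_cosh u₀).trans h1)]
        field_simp
    obtain ⟨k1, k2, k3⟩ := hu₀ u hu
    set w : ℂ := ⟨y 0, y 1⟩
    have hw : ‖w‖ = ‖y‖ := by
      rw [← sq_eq_sq₀ (norm_nonneg _) (norm_nonneg _), sq_norm_eq, EuclideanSpace.norm_sq_eq]
      simp [w, Fin.sum_univ_two]
    refine ⟨!₂[x₀ + ε * α * u, α * Real.cosh u * Real.cos w.arg, α * Real.cosh u * Real.sin w.arg],
      ⟨?_, ⟨_, ⟨u, k1, rfl⟩, w.arg, rfl⟩, ?_⟩, ?_⟩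
    · rw [mem_closedBall_zero_iff, norm_vec3]
      have h3 : ‖y‖ * (1 + δ) ≤ R := by
        rwa [le_div_iff₀ (by positivity)] at hy
      have h4 : 0 ≤ ‖y‖ := norm_nonneg y
      rw [hcu] at k3 ⊢
      rw [Real.sqrt_le_left hR]
      have h5 := Real.sin_sq_add_cos_sq w.arg
      have h6 : (x₀ + ε * α * u) ^ 2 ≤ (δ * ‖y‖) ^ 2 := sq_le_sq'
        (by linarith [neg_abs_le (x₀ + ε * α * u)])
        (by linarith [le_abs_self (x₀ + ε * α * u)])
      have h7 : (‖y‖ * (1 + δ)) ^ 2 ≤ R ^ 2 := by gcongr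
      have h8 : (‖y‖ * Real.cos w.arg) ^ 2 + (‖y‖ * Real.sin w.arg) ^ 2 = ‖y‖ ^ 2 := by
        linear_combination ‖y‖ ^ 2 * h5
      nlinarith [mul_nonneg (mul_nonneg hδ.le h4) h4]
    · simp only [mem_ofPred_eq]
      have : ε * (x₀ + ε * α * u) = ε * x₀ + α * u := by linear_combination α * u * hε
      simpa [this] using k2
    · rw [axisProj, eq_vec2 y, hcu, ← hw]
      simp only [Matrix.cons_val]
      rw [Complex.norm_mul_cos_arg, Complex.norm_mul_sin_arg]
  have hvol : ENNReal.ofReal ((1 / (1 + δ)) ^ 2 * (π * R ^ 2))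
      = volume (Metric.closedBall (0 : EuclideanSpace ℝ (Fin 2)) (R / (1 + δ))) := by
    rw [EuclideanSpace.volume_closedBall_fin_two, ← ENNReal.ofReal_pow (by positivity),
      ← ENNReal.ofReal_mul (by positivity)]
    congr 1
    field_simp
  rw [hvol]
  refine (measure_mono hsub).trans ((measure_union_le _ _).trans (add_le_add le_rfl ?_))
  rw [← EuclideanSpace.euclideanHausdorffMeasure_eq_volume]
  refine (lipschitzWith_axisProj.lipschitzOnWith
    (s := _)).euclideanHausdorffMeasure_image_le.trans (le_of_eq ?_)
  simp

theorem abs_sub_le_mul_abs_cosh_sub {δ u₀ : ℝ} (hδ : 0 < δ)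
    (hs : 1 / δ ≤ Real.sinh u₀) {u v : ℝ} (hu : u₀ ≤ u) (hv : u₀ ≤ v) :
    |u - v| ≤ δ * |Real.cosh u - Real.cosh v| := by
  wlog huv : u ≤ v generalizing u v
  · rw [abs_sub_comm u, abs_sub_comm (Real.cosh u)]
    exact this hv hu (le_of_not_ge huv)
  have h1 : 1 / δ * (v - u) ≤ Real.cosh v - Real.cosh u := by
    refine (convex_Ici u₀).mul_sub_le_image_sub_of_le_deriv Real.continuous_cosh.continuousOn
      Real.differentiable_cosh.differentiableOn (fun t ht => ?_) u hu v hv huv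
    rw [interior_Ici] at ht
    rw [Real.deriv_cosh]
    exact hs.trans (Real.sinh_le_sinh.mpr (le_of_lt ht))
  have h2 : 0 ≤ v - u := by linarith
  rw [abs_sub_comm u, abs_of_nonneg h2, abs_sub_comm (Real.cosh u),
    abs_of_nonneg (le_trans (by positivity) h1)]
  calc v - u = δ * (1 / δ * (v - u)) := by field_simp
    _ ≤ _ := by gcongr

/-- Upper bound for the area of a half catenoid in a ball, up to an additive constant: far out it
is the graph of a `δ`-Lipschitz function over the plane orthogonal to the axis. -/
theorem catenoid_area_le (x₀ ε : ℝ) {α δ : ℝ} (hα : 0 < α) (hδ : 0 < δ) (hε : ε ^ 2 = 1) :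
    ∃ C : ℝ≥0∞, C ≠ ⊤ ∧ ∀ R : ℝ, 0 ≤ R → (Measure.euclideanHausdorffMeasure 2 : Measure E3)
        (Metric.closedBall 0 R ∩ rotSet (halfCatenary x₀ α ε))
      ≤ C + ENNReal.ofReal ((1 + δ) ^ 2 * (π * R ^ 2)) := by
  obtain ⟨u₀, hu₀, hs⟩ : ∃ u₀ : ℝ, 0 ≤ u₀ ∧ 1 / δ ≤ Real.sinh u₀ :=
    ⟨Real.arsinh (1 / δ), Real.arsinh_nonneg_iff.mpr (by positivity), (Real.sinh_arsinh _).ge⟩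
  set γ : ℝ → ℂ := fun u => ⟨x₀ + ε * α * u, α * Real.cosh u⟩ with hγ
  have hεabs : |ε| = 1 := (pow_eq_one_iff_of_nonneg (abs_nonneg ε) two_ne_zero).mp
    (by rw [sq_abs, hε])
  have hsplit : halfCatenary x₀ α ε ⊆ γ '' Icc 0 u₀ ∪ γ '' Ici u₀ := by
    rw [halfCatenary, ← image_union]
    refine image_mono fun u hu => ?_
    rcases le_total u u₀ with h | h
    · exact .inl ⟨hu, h⟩
    · exact .inr h
  have hd : ∀ u, HasDerivAt γ ⟨ε * α * 1, α * Real.sinh u⟩ u := fun u =>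
    hasDerivAt_mk (((hasDerivAt_id u).const_mul _).const_add _)
      ((Real.hasDerivAt_cosh u).const_mul α)
  have hfin : μH[2] (rotSet (γ '' Icc 0 u₀)) < ⊤ := by
    set K : NNReal := (α * Real.cosh u₀).toNNReal
    have hK : (K : ℝ) = α * Real.cosh u₀ :=
      Real.coe_toNNReal _ (mul_pos hα (Real.cosh_pos _)).le
    have hcosh : ∀ u ∈ Icc 0 u₀, Real.cosh u ≤ Real.cosh u₀ := fun u hu => by
      rw [Real.cosh_le_cosh, abs_of_nonneg hu.1, abs_of_nonneg hu₀]; exact hu.2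
    have hL : LipschitzOnWith K γ (Icc 0 u₀) := by
      refine Convex.lipschitzOnWith_of_nnnorm_hasDerivWithin_le (convex_Icc _ _)
        (fun t _ => (hd t).hasDerivWithinAt) fun t ht => ?_
      rw [← NNReal.coe_le_coe, coe_nnnorm, hK]
      have e : ‖(⟨ε * α * 1, α * Real.sinh t⟩ : ℂ)‖ = α * Real.cosh t := by
        rw [← sq_eq_sq₀ (norm_nonneg _) (mul_pos hα (Real.cosh_pos _)).le, sq_norm_eq]
        simp only
        have := Real.cosh_sq t
        linear_combination α ^ 2 * hε - α ^ 2 * this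
      rw [e]
      exact mul_le_mul_of_nonneg_left (hcosh t ht) hα.le
    have hB : ∀ u ∈ Icc 0 u₀, |(γ u).im| ≤ K := by
      intro u hu
      rw [hK]
      simp only [hγ]
      rw [abs_of_pos (mul_pos hα (Real.cosh_pos _))]
      exact mul_le_mul_of_nonneg_left (hcosh u hu) hα.le
    rw [← revSurface_eq_rotSet]
    refine (hausdorffMeasure_revSurface_le hL hB).trans_lt ?_
    rw [Real.volume_Icc]
    finiteness
  refine ⟨_, (euclideanHausdorffMeasure_lt_top hfin).ne, fun R hR => ?_⟩
  set f : EuclideanSpace ℝ (Fin 2) → E3 := fun y =>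
    !₂[x₀ + ε * α * Real.arcosh (‖y‖ / α), y 0, y 1] with hf
  set A : Set (EuclideanSpace ℝ (Fin 2)) := {y | α * Real.cosh u₀ ≤ ‖y‖} with hA
  have hAu : ∀ y ∈ A, Real.cosh u₀ ≤ ‖y‖ / α := fun y hy => by
    rw [le_div_iff₀ hα, mul_comm]; exact hy
  have hLf : LipschitzOnWith (1 + δ).toNNReal f A := by
    refine LipschitzOnWith.of_dist_le_mul fun y hy z hz => ?_
    rw [Real.coe_toNNReal _ (by positivity)]
    have hu : ∀ y ∈ A, u₀ ≤ Real.arcosh (‖y‖ / α) := fun y hy => by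
      have h2 := (Real.arcosh_le_arcosh (Real.cosh_pos u₀)
          ((Real.cosh_pos u₀).trans_le (hAu y hy))).mpr (hAu y hy)
      rwa [Real.arcosh_cosh hu₀] at h2
    have hcs : ∀ y ∈ A, Real.cosh (Real.arcosh (‖y‖ / α)) = ‖y‖ / α := fun y hy =>
      Real.cosh_arcosh ((Real.one_le_cosh u₀).trans (hAu y hy))
    have h1 := abs_sub_le_mul_abs_cosh_sub hδ hs (hu y hy) (hu z hz)
    rw [hcs y hy, hcs z hz] at h1
    have h2 : |‖y‖ - ‖z‖| ≤ dist y z := by rw [dist_eq_norm]; exact abs_norm_sub_norm_le y z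
    have h3 : |ε * α * Real.arcosh (‖y‖ / α) - ε * α * Real.arcosh (‖z‖ / α)| ≤ δ * dist y z := by
      rw [← mul_sub, abs_mul, abs_mul, hεabs, one_mul, abs_of_pos hα]
      calc α * |Real.arcosh (‖y‖ / α) - Real.arcosh (‖z‖ / α)|
          ≤ α * (δ * |‖y‖ / α - ‖z‖ / α|) := by gcongr
        _ = δ * |‖y‖ - ‖z‖| := by
            rw [← sub_div, abs_div, abs_of_pos hα]; field_simp
        _ ≤ _ := by gcongr
    have h4 : dist y z ^ 2 = (y 0 - z 0) ^ 2 + (y 1 - z 1) ^ 2 := by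
      rw [EuclideanSpace.dist_sq_eq, Fin.sum_univ_two, Real.dist_eq, Real.dist_eq, sq_abs, sq_abs]
    have hdn : 0 ≤ dist y z := dist_nonneg
    rw [dist_eq_norm, hf, sub_vec3, norm_vec3, Real.sqrt_le_left (by positivity)]
    have h5 : (x₀ + ε * α * Real.arcosh (‖y‖ / α) - (x₀ + ε * α * Real.arcosh (‖z‖ / α))) ^ 2
        ≤ (δ * dist y z) ^ 2 := by
      rw [add_sub_add_left_eq_sub]
      exact sq_le_sq' (by linarith [neg_abs_le (ε * α * Real.arcosh (‖y‖ / α)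
          - ε * α * Real.arcosh (‖z‖ / α))])
        ((le_abs_self _).trans h3)
    nlinarith [mul_nonneg (mul_nonneg hδ.le hdn) hdn]
  have hsub : Metric.closedBall 0 R ∩ rotSet (halfCatenary x₀ α ε)
      ⊆ rotSet (γ '' Icc 0 u₀) ∪ f '' (A ∩ Metric.closedBall 0 R) := by
    rintro p ⟨hpR, hp⟩
    have hp := rotSet_mono hsplit hp
    rw [rotSet_union] at hp
    rcases hp with hp | ⟨_, ⟨u, hu, rfl⟩, φ, rfl⟩
    · exact .inl hp
    right
    have hu' : u₀ ≤ u := hu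
    have hpos : 0 < α * Real.cosh u := mul_pos hα (Real.cosh_pos _)
    have hn : ‖(!₂[α * Real.cosh u * Real.cos φ, α * Real.cosh u * Real.sin φ] :
        EuclideanSpace ℝ (Fin 2))‖ = α * Real.cosh u := by
      rw [norm_vec2, Real.sqrt_eq_iff_mul_self_eq (by positivity) hpos.le]
      linear_combination ((α * Real.cosh u) ^ 2) * Real.sin_sq_add_cos_sq φ
    refine ⟨!₂[α * Real.cosh u * Real.cos φ, α * Real.cosh u * Real.sin φ], ⟨?_, ?_⟩, ?_⟩
    · rw [hA, mem_ofPred_eq, hn]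
      refine mul_le_mul_of_nonneg_left ?_ hα.le
      rw [Real.cosh_le_cosh, abs_of_nonneg hu₀, abs_of_nonneg (hu₀.trans hu')]
      exact hu'
    · rw [mem_closedBall_zero_iff] at hpR ⊢
      refine le_trans ?_ hpR
      rw [norm_vec2, norm_vec3]
      refine Real.sqrt_le_sqrt ?_
      simp only [hγ]
      nlinarith [sq_nonneg (x₀ + ε * α * u)]
    · simp only [hf, hn]
      rw [mul_div_cancel_left₀ _ hα.ne', Real.arcosh_cosh (hu₀.trans hu')]
      simp [hγ]
  refine (measure_mono hsub).trans ((measure_union_le _ _).trans (add_le_add le_rfl ?_))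
  refine (hLf.mono inter_subset_left).euclideanHausdorffMeasure_image_le.trans ?_
  rw [EuclideanSpace.euclideanHausdorffMeasure_eq_volume]
  refine (mul_le_mul_right (measure_mono inter_subset_right) _).trans (le_of_eq ?_)
  rw [EuclideanSpace.volume_closedBall_fin_two]
  change ENNReal.ofReal (1 + δ) ^ 2 * _ = _
  rw [← ENNReal.ofReal_pow (by positivity), ← ENNReal.ofReal_pow hR,
    ← ENNReal.ofReal_mul (by positivity), ← ENNReal.ofReal_mul (by positivity)]
  congr 1
  ring

/-! ### The closed Willmore energy -/

/-- Two half catenoids that open in opposite directions have density one each. The half spaces `p₀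
> 1` and `p₀ ≤ 1` separate them far out, so that their areas add up. -/
theorem densityAtInfinity_union_halfCatenoids {α α' : ℝ} (hα : 0 < α) (hα' : 0 < α') :
    densityAtInfinity (rotSet (halfCatenary (-1) α 1) ∪ rotSet (halfCatenary 1 α' (-1))) = 2 := by
  set S₁ := rotSet (halfCatenary (-1) α 1)
  set S₂ := rotSet (halfCatenary 1 α' (-1))
  set μ : Measure E3 := Measure.euclideanHausdorffMeasure 2
  set A : ℝ → ℝ≥0∞ := fun R => ENNReal.ofReal (π * R ^ 2) with hA
  have hA0 : ∀ R : ℝ, 0 < R → A R ≠ 0 := fun R hR => by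
    simp only [hA, ne_eq, ENNReal.ofReal_eq_zero, not_le]; positivity
  have hAtop : ∀ R, A R ≠ ⊤ := fun R => ENNReal.ofReal_ne_top
  have hrestr : ∀ R, (μ.restrict (S₁ ∪ S₂)) (Metric.closedBall 0 R)
      = μ (Metric.closedBall 0 R ∩ (S₁ ∪ S₂)) := fun R =>
    Measure.restrict_apply Metric.isClosed_closedBall.measurableSet
  have hdiv : ∀ k R : ℝ, 0 ≤ k → 0 < R →
      (ENNReal.ofReal (k * (π * R ^ 2)) + ENNReal.ofReal (k * (π * R ^ 2))) / A R
        = ENNReal.ofReal (2 * k) := fun k R hk hR => by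
    rw [← ENNReal.ofReal_add (by positivity) (by positivity), hA,
      ← ENNReal.ofReal_div_of_pos (by positivity)]
    congr 1
    field_simp
    ring
  have upper : ∀ δ : ℝ, 0 < δ → densityAtInfinity (S₁ ∪ S₂) ≤ ENNReal.ofReal (2 * (1 + δ) ^ 2) := by
    intro δ hδ
    obtain ⟨C₁, hC₁, h₁⟩ := catenoid_area_le (-1) 1 hα hδ (by norm_num)
    obtain ⟨C₂, hC₂, h₂⟩ := catenoid_area_le 1 (-1) hα' hδ (by norm_num)
    have hlim : Tendsto (fun R => (C₁ + C₂) / A R + ENNReal.ofReal (2 * (1 + δ) ^ 2)) atTop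
        (𝓝 (0 + ENNReal.ofReal (2 * (1 + δ) ^ 2))) :=
      (tendsto_div_area (ENNReal.add_ne_top.mpr ⟨hC₁, hC₂⟩)).add tendsto_const_nhds
    rw [zero_add] at hlim
    rw [densityAtInfinity, ← hlim.limsup_eq]
    refine limsup_le_limsup ?_
    filter_upwards [eventually_gt_atTop 0] with R hR
    rw [hrestr, ← hdiv _ R (sq_nonneg _) hR, ← ENNReal.add_div]
    refine ENNReal.div_le_div_right ?_ _
    rw [inter_union_distrib_left]
    refine (measure_union_le _ _).trans ((add_le_add (h₁ R hR.le) (h₂ R hR.le)).trans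
      (le_of_eq ?_))
    ring
  have lower : ∀ δ : ℝ, 0 < δ →
      ENNReal.ofReal (2 * (1 / (1 + δ)) ^ 2) ≤ densityAtInfinity (S₁ ∪ S₂) := by
    intro δ hδ
    obtain ⟨C₁, hC₁, h₁⟩ := catenoid_area_ge (-1) 1 1 hα hδ (by norm_num)
    obtain ⟨C₂, hC₂, h₂⟩ := catenoid_area_ge 1 (-1) 1 hα' hδ (by norm_num)
    have hlim : Tendsto (fun R => ENNReal.ofReal (2 * (1 / (1 + δ)) ^ 2) - (C₁ + C₂) / A R) atTop
        (𝓝 (ENNReal.ofReal (2 * (1 / (1 + δ)) ^ 2) - 0)) :=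
      ENNReal.Tendsto.sub tendsto_const_nhds
        (tendsto_div_area (ENNReal.add_ne_top.mpr ⟨hC₁, hC₂⟩)) (.inl ENNReal.ofReal_ne_top)
    rw [tsub_zero] at hlim
    rw [densityAtInfinity, ← hlim.limsup_eq]
    refine limsup_le_limsup ?_
    filter_upwards [eventually_gt_atTop 0] with R hR
    rw [hrestr, tsub_le_iff_left, ← hdiv _ R (sq_nonneg _) hR, ← ENNReal.add_div]
    refine ENNReal.div_le_div_right ?_ _
    have hH : MeasurableSet {p : E3 | 1 < 1 * p 0} :=
      (isOpen_lt continuous_const (by fun_prop)).measurableSet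
    have hdec := measure_inter_add_sdiff (μ := μ) (Metric.closedBall 0 R ∩ (S₁ ∪ S₂)) hH
    rw [← hdec]
    refine (add_le_add (h₁ R hR.le) (h₂ R hR.le)).trans ?_
    rw [add_add_add_comm]
    refine add_le_add le_rfl (add_le_add (measure_mono ?_) (measure_mono ?_))
    · rintro p ⟨hp1, hp2, hp3⟩
      exact ⟨⟨hp1, .inl hp2⟩, hp3⟩
    · rintro p ⟨hp1, hp2, hp3⟩
      refine ⟨⟨hp1, .inr hp2⟩, fun hp4 => ?_⟩
      simp only [mem_ofPred_eq] at hp3 hp4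
      linarith
  have l1 : Tendsto (fun δ : ℝ => ENNReal.ofReal (2 * (1 + δ) ^ 2)) (𝓝[>] 0) (𝓝 2) := by
    have : Tendsto (fun δ : ℝ => ENNReal.ofReal (2 * (1 + δ) ^ 2)) (𝓝 0)
        (𝓝 (ENNReal.ofReal (2 * (1 + 0) ^ 2))) :=
      ENNReal.tendsto_ofReal (Continuous.tendsto (by fun_prop) 0)
    rw [show (2 : ℝ) * (1 + 0) ^ 2 = 2 by norm_num, ENNReal.ofReal_ofNat] at this
    exact this.mono_left nhdsWithin_le_nhds
  have l2 : Tendsto (fun δ : ℝ => ENNReal.ofReal (2 * (1 / (1 + δ)) ^ 2)) (𝓝[>] 0) (𝓝 2) := by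
    have : Tendsto (fun δ : ℝ => ENNReal.ofReal (2 * (1 / (1 + δ)) ^ 2)) (𝓝 0)
        (𝓝 (ENNReal.ofReal (2 * (1 / (1 + 0)) ^ 2))) :=
      ENNReal.tendsto_ofReal (((tendsto_const_nhds.div (tendsto_id.const_add 1)
        (by norm_num)).pow 2).const_mul 2)
    rw [show (2 : ℝ) * (1 / (1 + 0)) ^ 2 = 2 by norm_num, ENNReal.ofReal_ofNat] at this
    exact this.mono_left nhdsWithin_le_nhds
  refine le_antisymm (ge_of_tendsto l1 ?_) (le_of_tendsto l2 ?_)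
  · filter_upwards [self_mem_nhdsWithin] with δ hδ using upper δ hδ
  · filter_upwards [self_mem_nhdsWithin] with δ hδ using lower δ hδ

theorem revSurface_unionCurve (cm cp : ℝ → ℂ) :
    revSurface (unionCurve cm cp) (Icc 0 2 \ {1})
      = rotSet (cm '' Ico 0 1) ∪ rotSet (cp '' Ico 0 1) := by
  rw [revSurface_eq_rotSet, ← rotSet_union]
  congr 1
  ext z
  constructor
  · rintro ⟨s, ⟨hs, hs1⟩, rfl⟩
    by_cases h : s < 1
    · exact .inl ⟨s, ⟨hs.1, h⟩, (if_pos h).symm⟩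
    · have h1 : 1 < s := lt_of_le_of_ne (not_lt.mp h) (Ne.symm hs1)
      exact .inr ⟨2 - s, ⟨by linarith [hs.2], by linarith⟩, (if_neg h).symm⟩
  · rintro (⟨s, hs, rfl⟩ | ⟨s, hs, rfl⟩)
    · exact ⟨s, ⟨⟨hs.1, by linarith [hs.2]⟩, hs.2.ne⟩, if_pos hs.2⟩
    · refine ⟨2 - s, ⟨⟨by linarith [hs.2], by linarith [hs.1]⟩, fun h => ?_⟩, ?_⟩
      · rw [mem_singleton_iff] at h
        linarith [hs.2]
      · rw [unionCurve, if_neg (by linarith [hs.2]), sub_sub_cancel]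

theorem singularEnergy_real {αm αp x : ℝ} {cm cp : ℝ → ℂ} (hαm : 0 < αm) (hαp : 0 < αp)
    (hm : IsSingularArc (-1) αm 0 (x : OnePoint ℝ) cm)
    (hp : IsSingularArc 1 αp π (x : OnePoint ℝ) cp) :
    singularEnergy (-1) αm 0 1 αp π cm cp
      = ENNReal.ofReal (12 * π + 4 * π * (αp * (x - 1) / (αp ^ 2 + (x - 1) ^ 2)
          - αm * (x + 1) / (αm ^ 2 + (x + 1) ^ 2))) := by
  obtain ⟨_, _, Fm, hFm⟩ := hm.willmorePrimitive_real hαm Real.sin_zero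
  obtain ⟨_, _, Fp, hFp⟩ := hp.willmorePrimitive_real hαp Real.sin_pi
  have hdens : densityAtInfinity (revSurface (unionCurve cm cp) (Icc 0 2 \ {1})) = 0 := by
    rw [revSurface_unionCurve]
    exact densityAtInfinity_eq_zero ((measure_union_le _ _).trans_lt
      (ENNReal.add_lt_top.mpr ⟨hm.hausdorffMeasure_lt_top, hp.hausdorffMeasure_lt_top⟩))
  have hDm : 0 < αm ^ 2 + (x + 1) ^ 2 := by positivity
  have hDp : 0 < αp ^ 2 + (x - 1) ^ 2 := by positivity
  have em : 2 - -(2 * Real.cos 0 * (-1 - x) * αm) / (αm ^ 2 + (-1 - x) ^ 2)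
      = 2 - 2 * (αm * (x + 1) / (αm ^ 2 + (x + 1) ^ 2)) := by
    rw [Real.cos_zero, show (-1 - x) ^ 2 = (x + 1) ^ 2 by ring]
    field_simp
    ring
  have ep : 2 - -(2 * Real.cos π * (1 - x) * αp) / (αp ^ 2 + (1 - x) ^ 2)
      = 2 + 2 * (αp * (x - 1) / (αp ^ 2 + (x - 1) ^ 2)) := by
    rw [Real.cos_pi, show (1 - x) ^ 2 = (x - 1) ^ 2 by ring]
    field_simp
    ring
  have hm1 : 0 ≤ 2 - 2 * (αm * (x + 1) / (αm ^ 2 + (x + 1) ^ 2)) := by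
    have : αm * (x + 1) / (αm ^ 2 + (x + 1) ^ 2) ≤ 1 := by
      rw [div_le_one hDm]; nlinarith [sq_nonneg (αm - (x + 1))]
    linarith
  have hp1 : 0 ≤ 2 + 2 * (αp * (x - 1) / (αp ^ 2 + (x - 1) ^ 2)) := by
    have : -1 ≤ αp * (x - 1) / (αp ^ 2 + (x - 1) ^ 2) := by
      rw [le_div_iff₀ hDp]; nlinarith [sq_nonneg (αp + (x - 1))]
    linarith
  rw [singularEnergy, closedWillmore, revWillmore_unionCurve hFm hFp, hdens,
    revWillmore_capCurve hαm Real.sin_zero, revWillmore_capCurve hαp Real.sin_pi,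
    densityAtInfinity_capCurve hαm Real.sin_zero, densityAtInfinity_capCurve hαp Real.sin_pi,
    em, ep, mul_zero, add_zero, add_zero, add_zero, ← ENNReal.ofReal_add hm1 hp1,
    ← ENNReal.ofReal_mul (by positivity), ← ENNReal.ofReal_add (by positivity) (by positivity),
    ← ENNReal.ofReal_add (by positivity) (by positivity)]
  congr 1
  ring

theorem singularEnergy_infty {αm αp : ℝ} {cm cp : ℝ → ℂ} (hαm : 0 < αm) (hαp : 0 < αp)
    (hm : IsSingularArc (-1) αm 0 OnePoint.infty cm)
    (hp : IsSingularArc 1 αp π OnePoint.infty cp) :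
    singularEnergy (-1) αm 0 1 αp π cm cp = ENNReal.ofReal (12 * π) := by
  obtain ⟨_, _, Fm, hFm⟩ := hm.willmorePrimitive_infty
  obtain ⟨_, _, Fp, hFp⟩ := hp.willmorePrimitive_infty
  rw [singularEnergy, closedWillmore, revWillmore_unionCurve hFm hFp, revSurface_unionCurve,
    hm.image_eq_halfCatenary Real.sin_zero, hp.image_eq_halfCatenary Real.sin_pi, Real.cos_zero,
    Real.cos_pi, densityAtInfinity_union_halfCatenoids hαm hαp,
    revWillmore_capCurve hαm Real.sin_zero, revWillmore_capCurve hαp Real.sin_pi,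
    densityAtInfinity_capCurve hαm Real.sin_zero, densityAtInfinity_capCurve hαp Real.sin_pi,
    sub_zero, ENNReal.ofReal_zero, add_zero, mul_zero, mul_zero, add_zero, add_zero, zero_add,
    ← ENNReal.ofReal_add (by positivity) (by positivity),
    show (2 : ℝ≥0∞) = ENNReal.ofReal 2 by simp, ← ENNReal.ofReal_mul (by positivity),
    ← ENNReal.ofReal_add (by positivity) (by positivity)]
  congr 1
  ring

/-- Each of the two fractions in the energy formula has absolute value at most `1 / 2`. For `x ≤ -1`
the second one has the favourable sign; for `x ≥ -1` the first one is at least `-2 / αp`. -/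
theorem infSingularEnergy_ge {αm αp : ℝ} (hαm : 0 < αm) (hαp : 0 < αp) :
    ENNReal.ofReal (10 * π - 8 * π / αp) ≤ infSingularEnergy (-1) αm 0 1 αp π := by
  have hπ := Real.pi_pos
  have hq : 0 < 8 * π / αp := by positivity
  refine le_iInf fun x => le_iInf fun cm => le_iInf fun cp => le_iInf fun hm => le_iInf fun hp => ?_
  induction x using OnePoint.rec with
  | infty =>
    rw [singularEnergy_infty hαm hαp hm hp]
    exact ENNReal.ofReal_le_ofReal (by linarith)
  | coe x =>
    rw [singularEnergy_real hαm hαp hm hp]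
    refine ENNReal.ofReal_le_ofReal ?_
    have hDm : 0 < αm ^ 2 + (x + 1) ^ 2 := by positivity
    have hDp : 0 < αp ^ 2 + (x - 1) ^ 2 := by positivity
    have key : -(1 / 2) - 2 / αp ≤ αp * (x - 1) / (αp ^ 2 + (x - 1) ^ 2)
        - αm * (x + 1) / (αm ^ 2 + (x + 1) ^ 2) := by
      rcases le_total x (-1) with hx | hx
      · have h1 : -(1 / 2) ≤ αp * (x - 1) / (αp ^ 2 + (x - 1) ^ 2) := by
          rw [le_div_iff₀ hDp]; nlinarith [sq_nonneg (αp + (x - 1))]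
        have h2 : αm * (x + 1) / (αm ^ 2 + (x + 1) ^ 2) ≤ 0 :=
          div_nonpos_of_nonpos_of_nonneg
            (mul_nonpos_of_nonneg_of_nonpos hαm.le (by linarith)) hDm.le
        have : 0 < 2 / αp := by positivity
        linarith
      · have h1 : -(2 / αp) ≤ αp * (x - 1) / (αp ^ 2 + (x - 1) ^ 2) := by
          rw [le_div_iff₀ hDp]
          have e : -(2 / αp) * (αp ^ 2 + (x - 1) ^ 2)
              = -(2 * αp) - 2 / αp * (x - 1) ^ 2 := by
            field_simp
            ring
          have : 0 ≤ 2 / αp * (x - 1) ^ 2 := by positivity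
          rw [e]
          nlinarith
        have h2 : αm * (x + 1) / (αm ^ 2 + (x + 1) ^ 2) ≤ 1 / 2 := by
          rw [div_le_iff₀ hDm]; nlinarith [sq_nonneg (αm - (x + 1))]
        linarith
    have h3 := mul_le_mul_of_nonneg_left key (show 0 ≤ 4 * π by positivity)
    have e : 4 * π * (-(1 / 2) - 2 / αp) = -(2 * π) - 8 * π / αp := by ring
    linarith

theorem exists_singularArcs_iff {αm αp : ℝ} (hαm : 0 < αm) (hαp : 0 < αp) (x : OnePoint ℝ) :
    (∃ cm cp : ℝ → ℂ, IsSingularArc (-1) αm 0 x cm ∧ IsSingularArc 1 αp π x cp) ↔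
      x ≠ ((-1 - αm : ℝ) : OnePoint ℝ) ∧ x ≠ ((1 + αp : ℝ) : OnePoint ℝ) := by
  induction x using OnePoint.rec with
  | infty =>
    obtain ⟨cm, hm⟩ := exists_isSingularArc_infty (x₀ := -1) hαm Real.sin_zero
    obtain ⟨cp, hp⟩ := exists_isSingularArc_infty (x₀ := 1) hαp Real.sin_pi
    exact ⟨fun _ => ⟨OnePoint.infty_ne_coe _, OnePoint.infty_ne_coe _⟩, fun _ => ⟨cm, cp, hm, hp⟩⟩
  | coe x =>
    have em : -1 - Real.cos 0 * αm = -1 - αm := by rw [Real.cos_zero, one_mul]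
    have ep : 1 - Real.cos π * αp = 1 + αp := by rw [Real.cos_pi]; ring
    simp only [ne_eq, OnePoint.coe_eq_coe]
    constructor
    · rintro ⟨cm, cp, hm, hp⟩
      exact ⟨em ▸ hm.ne_of_real hαm Real.sin_zero, ep ▸ hp.ne_of_real hαp Real.sin_pi⟩
    · rintro ⟨h1, h2⟩
      obtain ⟨cm, hm⟩ := exists_isSingularArc_real (x₀ := -1) hαm Real.sin_zero (by rwa [em])
      obtain ⟨cp, hp⟩ := exists_isSingularArc_real (x₀ := 1) hαp Real.sin_pi (by rwa [ep])
      exact ⟨cm, cp, hm, hp⟩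

end

theorem theorem1p2 :
    -- the energy formula
    (∀ αm αp : ℝ, 0 < αm → 0 < αp →
      (∀ (x : ℝ) (cm cp : ℝ → ℂ),
        IsSingularArc (-1) αm 0 (x : OnePoint ℝ) cm → IsSingularArc 1 αp π (x : OnePoint ℝ) cp →
        singularEnergy (-1) αm 0 1 αp π cm cp
          = ENNReal.ofReal (12 * π + 4 * π * (αp * (x - 1) / (αp ^ 2 + (x - 1) ^ 2)
              - αm * (x + 1) / (αm ^ 2 + (x + 1) ^ 2)))) ∧
      (∀ cm cp : ℝ → ℂ,
        IsSingularArc (-1) αm 0 OnePoint.infty cm → IsSingularArc 1 αp π OnePoint.infty cp →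
        singularEnergy (-1) αm 0 1 αp π cm cp = ENNReal.ofReal (12 * π)) ∧
      -- the points for which the curve exists
      (∀ x : OnePoint ℝ,
        (∃ cm cp : ℝ → ℂ, IsSingularArc (-1) αm 0 x cm ∧ IsSingularArc 1 αp π x cp) ↔
          x ≠ ((-1 - αm : ℝ) : OnePoint ℝ) ∧ x ≠ ((1 + αp : ℝ) : OnePoint ℝ))) ∧
    -- the asymptotics
    (∀ αm : ℝ, 0 < αm →
      ENNReal.ofReal (10 * π) ≤
        liminf (fun αp : ℝ => infSingularEnergy (-1) αm 0 1 αp π) atTop) := by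
  refine ⟨fun αm αp hαm hαp => ⟨fun x cm cp hm hp => singularEnergy_real hαm hαp hm hp,
    fun cm cp hm hp => singularEnergy_infty hαm hαp hm hp,
    fun x => exists_singularArcs_iff hαm hαp x⟩, fun αm hαm => ?_⟩
  have hlim : Tendsto (fun αp : ℝ => ENNReal.ofReal (10 * π - 8 * π / αp)) atTop
      (𝓝 (ENNReal.ofReal (10 * π - 0))) :=
    ENNReal.tendsto_ofReal ((tendsto_const_nhds.div_atTop tendsto_id).const_sub _)
  rw [sub_zero] at hlim
  rw [← hlim.liminf_eq]
  refine liminf_le_liminf ?_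
  filter_upwards [eventually_gt_atTop 0] with αp hαp using infSingularEnergy_ge hαm hαp
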